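/- **Definitions.** A function $w:(0,\infty)\to(0,\infty)$ is a *modulus of continuity* (MOC) if it is continuous, nondecreasing, concave, and piecewise $C^2$ on $(0,\infty)$ (locally finitely many break points, with finite one-sided derivatives up to order two at every point of $(0,\infty)$). A function $f:\mathbb R^n\to\mathbb R$ *obeys* $w$ if $|f(x)-f(y)|<w(|x-y|)$ for all $x\neq y$. For $y\ge0$, $w^{-1}(y)\in[0,\infty]$ denotes the infimum of all $\xi>0$ with $w(\xi)\ge y$ (it is $\infty$ if there are none). $\Lambda^\beta=(-\Delta)^{\beta/2}$. **Statement.** Let $n\ge1$ and $\beta\in(0,2]$. There is a constant $c_\beta>0$ depending only on $\beta$ and $n$ such that the following holds. Let $\nu>0$, $\epsilon\ge0$, $T>0$, $\delta_1\in[\tfrac23,1)$. Let $\theta:[0,T]\times\mathbb R^n\to\mathbb R$ be a smooth solution of $$\partial_t\theta+u\cdot\nabla\theta+\nu\Lambda^\beta\theta-\epsilon\Delta\theta=0\quad\text{on }(0,T]\times\mathbb R^n,\qquad \theta(0,\cdot)=\theta_0,$$ that is: $\theta$ is $C^\infty$ on $(0,T]\times\mathbb R^n$, continuous and bounded on $[0,T]\times\mathbb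 R^n$, $\theta_0\in C^1$, $\nabla\theta\in C([0,T];L^\infty(\mathbb R^n))$, and the velocity satisfies $|u(t,x)|\le K(1+|x|)$ on $(0,T]\times\mathbb R^n$ for some $K$. Assume that for every $t\in(0,T]$, $\|\nabla\theta(t)\|_{L^\infty(\{|x|>R\})}\to0$ as $R\to\infty$. Let $\omega(t,\xi)$, $t\ge0$, $\xi>0$, be such that 1. for every $t\ge0$, $\omega(t,\cdot)$ is a MOC and $\omega^{-1}\big(t,\tfrac2{\delta_1}\|\theta_0\|_{L^\infty}\big)<\infty$; 2. for every $\xi>0$, $\omega(\cdot,\xi)$ is piecewise $C^1$ on $[0,\infty)$ with one-sided derivatives at all points; and for every $t\ge0$ there is $M>0$ such that for every $e>0$ there is $h>0$ with $|\omega(s,\xi)-\omega(t,\xi)|\le e$ for all $\xi\ge M$ and all $s\ge0$ with $|s-t|\le h$; 3. $\omega(t,0+)$ and $\partial_\xi\omega(t,0+)\in[0,\infty]$ are continuous in $t\ge0$, and one of the following holds: (a) $\omega(t,0+)>0$ for every $t\ge0$; (b) $\omega(t,0+)=0$ and $\partial_\xi\omega(t,0+)=\infty$ for every $t\ge0$;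 (c) $\omega(t,0+)=0$, $\partial_\xi\omega(t,0+)<\infty$ and $\partial_{\xi\xi}\omega(t,0+)=-\infty$ for every $t\ge0$. Let $\theta_0$ obey $\omega(0,\cdot)$. Let $\Omega(t,\xi)$ be a real function such that, for all $t\in(0,T]$ and $\xi>0$ with $\omega(t,\xi)\le2\|\theta(t,\cdot)\|_{L^\infty}$, $$|(u(t,x+\xi e)-u(t,x))\cdot e|\le\Omega(t,\xi)\quad\text{for every }x\in\mathbb R^n\text{ and every unit vector }e,$$ and $$\partial_t\omega(t,\xi)>\Omega(t,\xi)\,\partial_\xi\omega(t,\xi)+\nu\Upsilon_\beta(t,\xi)+2\epsilon\,\partial_{\xi\xi}\omega(t,\xi).$$ Here, for $\beta\in(0,2)$, $$\Upsilon_\beta(t,\xi)=c_\beta\int_0^{\xi/2}\frac{\omega(t,\xi+2\eta)+\omega(t,\xi-2\eta)-2\omega(t,\xi)}{\eta^{1+\beta}}\,d\eta+c_\beta\int_{\xi/2}^\infty\frac{\omega(t,2\eta+\xi)-\omega(t,2\eta-\xi)-2\omega(t,\xi)}{\eta^{1+\beta}}\,d\eta\in[-\infty,0]$$ (both integrands are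 nonpositive), and $\Upsilon_2(t,\xi)=2\,\partial_{\xi\xi}\omega(t,\xi)$. Where $\partial_t\omega$, $\partial_\xi\omega$ or $\partial_{\xi\xi}\omega$ does not exist, the smaller, the larger and the smaller of the one-sided values, respectively, is taken. Then $\theta(T,\cdot)$ obeys $\omega(T,\cdot)$. -/

import Mathlib

open Set Filter Topology MeasureTheory
open scoped ENNReal

namespace ActiveScalar

noncomputable section

/-- The Euclidean space `ℝⁿ`. -/
abbrev E (n : ℕ) : Type := EuclideanSpace ℝ (Fin n)

/-- The sup norm `‖f‖_{L^∞}` of a function (used for bounded continuous functions only). -/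
def supNorm {n : ℕ} (f : E n → ℝ) : ℝ := ⨆ x, |f x|

/-! ### One-sided derivatives and piecewise smoothness on the line -/

/-- Left derivative. -/
def leftD (f : ℝ → ℝ) (x : ℝ) : ℝ := derivWithin f (Iio x) x

/-- Right derivative. -/
def rightD (f : ℝ → ℝ) (x : ℝ) : ℝ := derivWithin f (Ioi x) x

/-- The first derivative; where it does not exist, the smaller one-sided derivative. -/
def lowerD (f : ℝ → ℝ) (x : ℝ) : ℝ := min (leftD f x) (rightD f x)

/-- The first derivative; where it does not exist, the larger one-sided derivative. -/
def upperD (f : ℝ → ℝ) (x : ℝ) : ℝ := max (leftD f x) (rightD f x)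

/-- The second derivative; where it does not exist, the smaller one-sided second derivative. -/
def secondD (f : ℝ → ℝ) (x : ℝ) : ℝ := min (leftD (leftD f) x) (rightD (rightD f) x)

/-- `f` is piecewise `C^k` on the interval `s`, with one-sided derivatives up to order `k` at every
point: to the left and to the right of every point of `s` there is a piece of `s`, *containing the
point as an end point*, on which `f` is `C^k`. (The break points are locally finite in `s`.) -/
def PiecewiseC (k : ℕ) (f : ℝ → ℝ) (s : Set ℝ) : Prop :=
  ∀ x ∈ s, ∃ r > 0, ContDiffOn ℝ k f (s ∩ Icc (x - r) x) ∧ ContDiffOn ℝ k f (s ∩ Icc x (x + r))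

/-! ### Moduli of continuity -/

/-- Moduli of continuity; only the values on `]0,∞[` matter. -/
structure IsMOC (w : ℝ → ℝ) : Prop where
  pos : ∀ ξ > 0, 0 < w ξ
  continuousOn : ContinuousOn w (Ioi 0)
  monotoneOn : MonotoneOn w (Ioi 0)
  concaveOn : ConcaveOn ℝ (Ioi 0) w
  piecewise : PiecewiseC 2 w (Ioi 0)

/-- `f` obeys the modulus of continuity `w`. -/
def Obeys {n : ℕ} (f : E n → ℝ) (w : ℝ → ℝ) : Prop :=
  ∀ x y, x ≠ y → |f x - f y| < w ‖x - y‖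

/-- The inverse `w⁻¹(y) ∈ [0,∞]` of a modulus of continuity: the least `ξ` at which `w` reaches the
level `y`, and `∞` if `w` never reaches it. -/
def mocInv (w : ℝ → ℝ) (y : ℝ) : ℝ≥0∞ :=
  ⨅ (ξ : ℝ) (_ : 0 < ξ) (_ : y ≤ w ξ), ENNReal.ofReal ξ

/-- The dissipation term `Υ_β` belonging to a modulus of continuity `w`. For `β ≠ 2` it is
`c ∫_0^{ξ/2} (w(ξ+2η) + w(ξ-2η) - 2w(ξ)) / η^{1+β} dη`
`+ c ∫_{ξ/2}^∞ (w(2η+ξ) - w(2η-ξ) - 2w(ξ)) / η^{1+β} dη`. Both integrands are nonpositive because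
`w` is concave and positive, so this is minus a Lebesgue integral with values in `[0,∞]` (the value
`-∞` occurs at corners of `w` when `β ≥ 1`). For `β = 2`, where the kernel is no longer
integrable against second differences, it is the local term `2 w''(ξ)`. -/
def Upsilon (c β : ℝ) (w : ℝ → ℝ) (ξ : ℝ) : EReal :=
  if β = 2 then ((2 * secondD w ξ : ℝ) : EReal)
  else
    -((ENNReal.ofReal c *
        ((∫⁻ η in Ioo 0 (ξ / 2),
            ENNReal.ofReal (-((w (ξ + 2 * η) + w (ξ - 2 * η) - 2 * w ξ) / η ^ (1 + β)))) +
          ∫⁻ η in Ioi (ξ / 2),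
            ENNReal.ofReal (-((w (2 * η + ξ) - w (2 * η - ξ) - 2 * w ξ) / η ^ (1 + β)))) :
        ℝ≥0∞) : EReal)

/-- Time-dependent moduli of continuity `ω(t,ξ)`, `t ≥ 0`, `ξ > 0`: for fixed `t` a modulus of
continuity, for fixed `ξ` piecewise `C¹` in time, and, for `ξ` near infinity, continuous in time
uniformly in `ξ`. -/
structure IsTimeMOC (ω : ℝ → ℝ → ℝ) : Prop where
  isMOC : ∀ t ≥ 0, IsMOC (ω t)
  piecewise_time : ∀ ξ > 0, PiecewiseC 1 (fun t => ω t ξ) (Ici 0)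
  uniform_at_infinity : ∀ t ≥ 0, ∃ M > 0, ∀ e > 0, ∃ h > 0, ∀ s ≥ 0, |s - t| ≤ h →
    ∀ ξ ≥ M, |ω s ξ - ω t ξ| ≤ e

/-- The behaviour of `ω` at `ξ = 0+`: `a t = ω(t,0+)` and `b t = ∂_ξω(t,0+)` (possibly `+∞`) are
continuous in time, and one of three alternatives holds:
`ω(t,0+) > 0` for all `t`; or `ω(t,0+) = 0` and `∂_ξω(t,0+) = ∞` for all `t`; or
`ω(t,0+) = 0`, `∂_ξω(t,0+) < ∞` and `∂_ξξω(t,0+) = -∞` for all `t`. -/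
def GoodAtZero (ω : ℝ → ℝ → ℝ) : Prop :=
  ∃ (a : ℝ → ℝ) (b : ℝ → EReal),
    (∀ t ≥ 0, Tendsto (ω t) (𝓝[>] 0) (𝓝 (a t))) ∧
    (∀ t ≥ 0, Tendsto (fun ξ => ((rightD (ω t) ξ : ℝ) : EReal)) (𝓝[>] 0) (𝓝 (b t))) ∧
    ContinuousOn a (Ici 0) ∧ ContinuousOn b (Ici 0) ∧
    ((∀ t ≥ 0, 0 < a t) ∨
      (∀ t ≥ 0, a t = 0 ∧ b t = ⊤) ∨
      (∀ t ≥ 0, a t = 0 ∧ b t < ⊤ ∧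
        Tendsto (rightD (rightD (ω t))) (𝓝[>] 0) atBot))

/-! ### The equation -/

/-- The normalizing constant of the singular integral for the Fourier multiplier `|ζ|^β` on `ℝⁿ`. -/
def fracLapConst (n : ℕ) (β : ℝ) : ℝ :=
  2 ^ β * Real.Gamma ((n + β) / 2) / (Real.pi ^ ((n : ℝ) / 2) * |Real.Gamma (-β / 2)|)

/-- The fractional Laplacian `Λ^β = (-Δ)^{β/2}`, `0 < β ≤ 2`, on bounded `C²` functions. -/
def fracLap {n : ℕ} (β : ℝ) (f : E n → ℝ) (x : E n) : ℝ :=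
  if β = 2 then -Laplacian.laplacian f x
  else fracLapConst n β / 2 *
    ∫ z : E n, (2 * f x - f (x + z) - f (x - z)) / ‖z‖ ^ ((n : ℝ) + β)

/-- `θ` is a smooth solution on `[0,T] × ℝⁿ` of
`∂ₜθ + u·∇θ + ν Λ^β θ - ε Δθ = 0` with initial datum `θ 0`: it is `C^∞` for positive times,
continuous up to `t = 0`, bounded, with `∇θ ∈ C([0,T]; L^∞)`, and the velocity has at most linear
growth in space. No further relation between `u` and `θ` is required. -/
structure IsSmoothSolution {n : ℕ} (β ν ε T : ℝ) (u : ℝ → E n → E n) (θ : ℝ → E n → ℝ) :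
    Prop where
  smooth : ContDiffOn ℝ (⊤ : ℕ∞) (Function.uncurry θ) (Ioc 0 T ×ˢ univ)
  continuousOn : ContinuousOn (Function.uncurry θ) (Icc 0 T ×ˢ univ)
  initial_C1 : ContDiff ℝ 1 (θ 0)
  bounded : ∃ C, ∀ t ∈ Icc 0 T, ∀ x, |θ t x| ≤ C
  gradient_continuous : ∀ t ∈ Icc 0 T, ∀ e > 0, ∃ h > 0, ∀ s ∈ Icc 0 T, |s - t| ≤ h →
    ∀ x, ‖gradient (θ s) x - gradient (θ t) x‖ ≤ e
  velocity_growth : ∃ K, ∀ t ∈ Ioc 0 T, ∀ x, ‖u t x‖ ≤ K * (1 + ‖x‖)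
  equation : ∀ t ∈ Ioc 0 T, ∀ x,
    derivWithin (fun s => θ s x) (Icc 0 T) t + inner ℝ (u t x) (gradient (θ t) x)
      + ν * fracLap β (θ t) x - ε * Laplacian.laplacian (θ t) x = 0

end

end ActiveScalar

open ActiveScalar

/-!
Let `F(t,x,y) = θ(t,x) - θ(t,y) - ω(t,|x-y|)` be the gap between the increments of the solution and
the modulus. The theorem says that `F < 0` at time `T`, and it follows from a maximum principle for
`F` in all its variables.

Suppose that `F` has a maximum `F₀ ≥ 0` over `[0,T]` and all pairs of distinct points, attained at
`(t,x,y)`. The initial datum obeys `ω(0,·)`, so `t > 0`. With `ξ = |x-y|` and `e = (x-y)/ξ`, the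
gradients of `θ` at `x` and `y` are both `∂_ξω e`, so the drift contributes at most `Ω ∂_ξω`
(`IsContact.fderiv_eq`); the Laplacians differ by at most `2 ∂_ξξω` (`IsContact.laplacian_sub_le`);
and the fractional dissipation contributes at most `ν Υ_β` (`fracLap_sub_le_Upsilon`). As `F(·,x,y)`
is largest at `t`, the left derivative of `ω(·,ξ)` is at most the time derivative of
`θ(·,x) - θ(·,y)`, and the differential inequality is violated (`not_isContact_of_lt`). The offset
`F₀` does no harm: it leaves the first two estimates unchanged and increases the dissipation.

For the dissipation estimate the second differences of `θ` at `x` and at `y` are compared on each line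
in direction `e`. There the kernel is an antitone function of the distance, and reflection about the
midpoint of `x` and `y` leads to a one-dimensional rearrangement inequality
(`lintegral_second_difference_le`). Integration over the transversal directions turns the kernel
`|z|^{-(n+β)}` into a multiple of `η^{-(1+β)}` (`lineConst_mul_lintegral_le`), which determines `c_β`.

It remains to see that a positive gap forces `F` to attain its maximum
(`IsSmoothSolution.exists_isMax_gap`). Points with gap above a positive level are apart because the
gradient is bounded, and stay in a compact set because the gradient vanishes at infinity uniformly in
time and because `ω(t,ξ) ≥ 2‖θ₀‖ ≥ 2‖θ(t)‖` for large `ξ`. The last inequality is the maximum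
principle for `θ` (`IsSmoothSolution.le_supNorm`), for which the barrier `δ (log (1 + |x|²) + C t)`
compensates the linear growth of the velocity. Hence `F ≤ 0` throughout, and a zero of `F` at time `T`
would be a maximum, which has been excluded.
-/

namespace ActiveScalar

/-! ### Concave functions and one-sided derivatives on the line -/

section Line

variable {w : ℝ → ℝ}

/-- A positive concave function on the half-line lies above its chords through the origin. -/
lemma mul_le_mul_of_concave_pos (hc : ConcaveOn ℝ (Ioi 0) w) (hp : ∀ ξ > 0, 0 < w ξ) {a b : ℝ}
    (ha : 0 < a) (hab : a ≤ b) : a * w b ≤ b * w a := by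
  rcases hab.eq_or_lt with rfl | hab
  · rfl
  have key : ∀ e ∈ Ioo 0 a, (w b - w a) * (a - e) ≤ w a * (b - a) := by
    intro e he
    have h1 := hc.slope_anti_adjacent (x := e) (y := a) (z := b) he.1 (ha.trans hab) he.2 hab
    have h2 : 0 < a - e := sub_pos.2 he.2
    have h3 : 0 < b - a := sub_pos.2 hab
    rw [div_le_div_iff₀ h3 h2] at h1
    nlinarith [hp e he.1]
  have ht : Tendsto (fun e : ℝ => (w b - w a) * (a - e)) (𝓝[>] 0) (𝓝 ((w b - w a) * (a - 0))) :=
    ((by fun_prop : Continuous fun e : ℝ => (w b - w a) * (a - e)).tendsto 0).mono_left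
      nhdsWithin_le_nhds
  have := le_of_tendsto ht (Filter.mem_of_superset (Ioo_mem_nhdsGT ha) key)
  nlinarith

/-- A positive concave function on the half-line is subadditive. -/
lemma add_le_of_concave_pos (hc : ConcaveOn ℝ (Ioi 0) w) (hp : ∀ ξ > 0, 0 < w ξ) {a b : ℝ}
    (ha : 0 < a) (hb : 0 < b) : w (a + b) ≤ w a + w b := by
  have h1 := mul_le_mul_of_concave_pos hc hp ha (by linarith : a ≤ a + b)
  have h2 := mul_le_mul_of_concave_pos hc hp hb (by linarith : b ≤ a + b)
  have : (a + b) * w (a + b) ≤ (a + b) * (w a + w b) := by nlinarith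
  exact le_of_mul_le_mul_left this (by linarith)

lemma add_sub_le_two_mul_of_concave (hc : ConcaveOn ℝ (Ioi 0) w) {a h : ℝ} (h1 : 0 < a - h)
    (h2 : 0 < a + h) : w (a + h) + w (a - h) ≤ 2 * w a := by
  have := hc.2 (mem_Ioi.2 h2) (mem_Ioi.2 h1) (by norm_num : (0 : ℝ) ≤ 1 / 2)
    (by norm_num : (0 : ℝ) ≤ 1 / 2) (by norm_num)
  simp only [smul_eq_mul] at this
  rw [show 1 / 2 * (a + h) + 1 / 2 * (a - h) = a by ring] at this
  linarith

/-- On a `C²` piece to the right of a point, the right derivatives of the first two orders are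
genuine one-sided derivatives. -/
lemma rightD_of_contDiffOn {f : ℝ → ℝ} {a r : ℝ} (hr : 0 < r)
    (h : ContDiffOn ℝ 2 f (Icc a (a + r))) :
    HasDerivWithinAt f (rightD f a) (Ioi a) a ∧
    HasDerivWithinAt (rightD f) (rightD (rightD f) a) (Ioi a) a ∧
    ∀ᶠ s in 𝓝[>] a, HasDerivAt f (rightD f s) s := by
  have hU : UniqueDiffOn ℝ (Icc a (a + r)) := uniqueDiffOn_Icc (by linarith)
  have hd : DifferentiableOn ℝ f (Icc a (a + r)) := h.differentiableOn (by norm_num)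
  have hd2 : DifferentiableOn ℝ (derivWithin f (Icc a (a + r))) (Icc a (a + r)) :=
    (h.derivWithin hU (m := 1) (by norm_num)).differentiableOn (by norm_num)
  have hmem : ∀ s ∈ Ico a (a + r), Icc a (a + r) ∈ 𝓝[>] s := fun s hs =>
    mem_of_superset (Ioo_mem_nhdsGT hs.2) fun y hy => ⟨hs.1.trans hy.1.le, hy.2.le⟩
  have hder : ∀ s ∈ Ico a (a + r),
      HasDerivWithinAt f (derivWithin f (Icc a (a + r)) s) (Ioi s) s := fun s hs =>
    ((hd s ⟨hs.1, hs.2.le⟩).hasDerivWithinAt).mono_of_mem_nhdsWithin (hmem s hs)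
  have heq : ∀ s ∈ Ico a (a + r), rightD f s = derivWithin f (Icc a (a + r)) s := fun s hs =>
    (hder s hs).derivWithin (uniqueDiffWithinAt_Ioi s)
  have ha : a ∈ Ico a (a + r) := ⟨le_rfl, by linarith⟩
  have hev : Ioo a (a + r) ∈ 𝓝[>] a := Ioo_mem_nhdsGT (by linarith)
  refine ⟨by rw [heq a ha]; exact hder a ha, ?_, ?_⟩
  · have h1 : HasDerivWithinAt (derivWithin f (Icc a (a + r)))
        (derivWithin (derivWithin f (Icc a (a + r))) (Icc a (a + r)) a) (Ioi a) a :=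
      ((hd2 a ⟨le_rfl, by linarith⟩).hasDerivWithinAt).mono_of_mem_nhdsWithin (hmem a ha)
    have h2 : HasDerivWithinAt (rightD f)
        (derivWithin (derivWithin f (Icc a (a + r))) (Icc a (a + r)) a) (Ioi a) a :=
      h1.congr_of_eventuallyEq
        (mem_of_superset hev fun s hs => heq s ⟨hs.1.le, hs.2⟩) (heq a ha)
    have h3 : rightD (rightD f) a = _ := h2.derivWithin (uniqueDiffWithinAt_Ioi a)
    rwa [h3]
  · filter_upwards [hev] with s hs
    rw [heq s ⟨hs.1.le, hs.2⟩]
    exact ((hd s ⟨hs.1.le, hs.2.le⟩).hasDerivWithinAt).hasDerivAt (Icc_mem_nhds hs.1 hs.2)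

/-- The counterpart of `rightD_of_contDiffOn` to the left of a point. -/
lemma leftD_of_contDiffOn {f : ℝ → ℝ} {a r : ℝ} (hr : 0 < r)
    (h : ContDiffOn ℝ 2 f (Icc (a - r) a)) :
    HasDerivWithinAt f (leftD f a) (Iio a) a ∧
    HasDerivWithinAt (leftD f) (leftD (leftD f) a) (Iio a) a ∧
    ∀ᶠ s in 𝓝[<] a, HasDerivAt f (leftD f s) s := by
  have hU : UniqueDiffOn ℝ (Icc (a - r) a) := uniqueDiffOn_Icc (by linarith)
  have hd : DifferentiableOn ℝ f (Icc (a - r) a) := h.differentiableOn (by norm_num)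
  have hd2 : DifferentiableOn ℝ (derivWithin f (Icc (a - r) a)) (Icc (a - r) a) :=
    (h.derivWithin hU (m := 1) (by norm_num)).differentiableOn (by norm_num)
  have hmem : ∀ s ∈ Ioc (a - r) a, Icc (a - r) a ∈ 𝓝[<] s := fun s hs =>
    mem_of_superset (Ioo_mem_nhdsLT hs.1) fun y hy => ⟨hy.1.le, hy.2.le.trans hs.2⟩
  have hder : ∀ s ∈ Ioc (a - r) a,
      HasDerivWithinAt f (derivWithin f (Icc (a - r) a) s) (Iio s) s := fun s hs =>
    ((hd s ⟨hs.1.le, hs.2⟩).hasDerivWithinAt).mono_of_mem_nhdsWithin (hmem s hs)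
  have heq : ∀ s ∈ Ioc (a - r) a, leftD f s = derivWithin f (Icc (a - r) a) s := fun s hs =>
    (hder s hs).derivWithin (uniqueDiffWithinAt_Iio s)
  have ha : a ∈ Ioc (a - r) a := ⟨by linarith, le_rfl⟩
  have hev : Ioo (a - r) a ∈ 𝓝[<] a := Ioo_mem_nhdsLT (by linarith)
  refine ⟨by rw [heq a ha]; exact hder a ha, ?_, ?_⟩
  · have h1 : HasDerivWithinAt (derivWithin f (Icc (a - r) a))
        (derivWithin (derivWithin f (Icc (a - r) a)) (Icc (a - r) a) a) (Iio a) a :=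
      ((hd2 a ⟨by linarith, le_rfl⟩).hasDerivWithinAt).mono_of_mem_nhdsWithin (hmem a ha)
    have h2 : HasDerivWithinAt (leftD f)
        (derivWithin (derivWithin f (Icc (a - r) a)) (Icc (a - r) a) a) (Iio a) a :=
      h1.congr_of_eventuallyEq
        (mem_of_superset hev fun s hs => heq s ⟨hs.1, hs.2.le⟩) (heq a ha)
    have h3 : leftD (leftD f) a = _ := h2.derivWithin (uniqueDiffWithinAt_Iio a)
    rwa [h3]
  · filter_upwards [hev] with s hs
    rw [heq s ⟨hs.1, hs.2.le⟩]
    exact ((hd s ⟨hs.1.le, hs.2.le⟩).hasDerivWithinAt).hasDerivAt (Icc_mem_nhds hs.1 hs.2)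

/-- The necessary second-order condition at a one-sided critical minimum. -/
lemma nonneg_of_isMin_of_deriv_eq_zero {g g' : ℝ → ℝ} {A : ℝ}
    (hg0 : ContinuousWithinAt g (Ici 0) 0) (hg : ∀ᶠ s in 𝓝[>] (0 : ℝ), HasDerivAt g (g' s) s)
    (h0 : g' 0 = 0) (hA : HasDerivWithinAt g' A (Ioi 0) 0)
    (hmin : ∀ᶠ s in 𝓝[>] (0 : ℝ), g 0 ≤ g s) : 0 ≤ A := by
  by_contra hneg
  push Not at hneg
  have hs : ∀ᶠ s in 𝓝[>] (0 : ℝ), g' s < 0 := by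
    have h1 := (hasDerivWithinAt_iff_tendsto_slope' (by simp)).1 hA
    filter_upwards [h1.eventually (gt_mem_nhds hneg), self_mem_nhdsWithin] with s hs hpos
    rw [slope_def_field, h0, sub_zero, sub_zero] at hs
    have hpos : (0 : ℝ) < s := hpos
    by_contra hge
    exact absurd hs (not_lt.2 (div_nonneg (not_lt.1 hge) hpos.le))
  obtain ⟨d, hd0, hd⟩ := mem_nhdsGT_iff_exists_Ioo_subset.1 (hg.and (hs.and hmin))
  have hd0 : (0 : ℝ) < d := hd0
  have hanti : StrictAntiOn g (Icc 0 (d / 2)) := by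
    refine strictAntiOn_of_deriv_neg (convex_Icc _ _) ?_ ?_
    · intro s hs
      rcases hs.1.eq_or_lt with rfl | hs0
      · exact hg0.mono Icc_subset_Ici_self
      · exact (hd ⟨hs0, by linarith [hs.2]⟩).1.continuousAt.continuousWithinAt
    · intro s hs
      rw [interior_Icc] at hs
      have := hd (⟨hs.1, by linarith [hs.2]⟩ : s ∈ Ioo 0 d)
      rw [this.1.deriv]
      exact this.2.1
  have h1 := hanti ⟨le_rfl, by linarith⟩ ⟨by linarith, le_rfl⟩ (by linarith : (0 : ℝ) < d / 2)
  have h2 := (hd (⟨by linarith, by linarith⟩ : d / 2 ∈ Ioo 0 d)).2.2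
  linarith

lemma nonneg_of_isMin_of_hasDerivAt {g g' : ℝ → ℝ} {A : ℝ} (hg : ∀ s, HasDerivAt g (g' s) s)
    (h0 : g' 0 = 0) (hA : HasDerivAt g' A 0) (hmin : ∀ s, g 0 ≤ g s) : 0 ≤ A :=
  nonneg_of_isMin_of_deriv_eq_zero (hg 0).continuousAt.continuousWithinAt
    (Eventually.of_forall hg) h0 hA.hasDerivWithinAt (Eventually.of_forall hmin)

end Line

namespace IsMOC

variable {w : ℝ → ℝ} {ξ : ℝ}

lemma exists_pieces (hw : IsMOC w) (hξ : 0 < ξ) : ∃ r > 0, r < ξ ∧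
    ContDiffOn ℝ 2 w (Icc (ξ - r) ξ) ∧ ContDiffOn ℝ 2 w (Icc ξ (ξ + r)) := by
  obtain ⟨r, hr, h1, h2⟩ := hw.piecewise ξ hξ
  refine ⟨min r (ξ / 2), lt_min hr (by linarith), (min_le_right _ _).trans_lt (by linarith),
    h1.mono fun s hs => ⟨?_, ?_, hs.2⟩, h2.mono fun s hs => ⟨?_, hs.1, ?_⟩⟩
  · exact lt_of_lt_of_le (by linarith [min_le_right r (ξ / 2)]) hs.1
  · exact le_trans (by linarith [min_le_left r (ξ / 2)]) hs.1
  · exact hξ.trans_le hs.1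
  · exact hs.2.trans (by linarith [min_le_left r (ξ / 2)])

/-- The right derivatives up to order two of a modulus of continuity exist; in particular `rightD`
has no junk values here. -/
lemma right (hw : IsMOC w) (hξ : 0 < ξ) : HasDerivWithinAt w (rightD w ξ) (Ioi ξ) ξ ∧
    HasDerivWithinAt (rightD w) (rightD (rightD w) ξ) (Ioi ξ) ξ ∧
    ∀ᶠ s in 𝓝[>] ξ, HasDerivAt w (rightD w s) s := by
  obtain ⟨r, hr, -, -, h⟩ := hw.exists_pieces hξ
  exact rightD_of_contDiffOn hr h

/-- The left derivatives up to order two of a modulus of continuity exist; in particular `leftD`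
has no junk values here. -/
lemma left (hw : IsMOC w) (hξ : 0 < ξ) : HasDerivWithinAt w (leftD w ξ) (Iio ξ) ξ ∧
    HasDerivWithinAt (leftD w) (leftD (leftD w) ξ) (Iio ξ) ξ ∧
    ∀ᶠ s in 𝓝[<] ξ, HasDerivAt w (leftD w s) s := by
  obtain ⟨r, hr, -, h, -⟩ := hw.exists_pieces hξ
  exact leftD_of_contDiffOn hr h

lemma rightD_nonneg (hw : IsMOC w) (hξ : 0 < ξ) : 0 ≤ rightD w ξ := by
  have h1 := (hasDerivWithinAt_iff_tendsto_slope' (by simp)).1 (hw.right hξ).1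
  refine ge_of_tendsto h1 ?_
  filter_upwards [self_mem_nhdsWithin] with s (hs : ξ < s)
  rw [slope_def_field]
  exact div_nonneg (sub_nonneg.2 (hw.monotoneOn hξ (hξ.trans hs) hs.le)) (sub_pos.2 hs).le

lemma rightD_le_leftD (hw : IsMOC w) (hξ : 0 < ξ) : rightD w ξ ≤ leftD w ξ := by
  have h1 := (hasDerivWithinAt_iff_tendsto_slope' (by simp)).1 (hw.right hξ).1
  have h2 := (hasDerivWithinAt_iff_tendsto_slope' (by simp)).1 (hw.left hξ).1
  refine ge_of_tendsto h2 ?_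
  filter_upwards [Ioo_mem_nhdsLT hξ] with s hs
  refine le_of_tendsto h1 ?_
  filter_upwards [self_mem_nhdsWithin] with r (hr : ξ < r)
  have := hw.concaveOn.slope_anti_adjacent (x := s) (y := ξ) (z := r) hs.1 (hξ.trans hr) hs.2 hr
  rw [slope_comm, slope_def_field, slope_comm, slope_def_field, ← neg_div_neg_eq, neg_sub, neg_sub]
  convert! this using 1

/-- Both one-sided derivatives, and everything in between, are supergradients. -/
lemma le_add_mul (hw : IsMOC w) (hξ : 0 < ξ) {m : ℝ} (hm1 : rightD w ξ ≤ m) (hm2 : m ≤ leftD w ξ)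
    {ρ : ℝ} (hρ : 0 < ρ) : w ρ ≤ w ξ + m * (ρ - ξ) := by
  have h1 := (hasDerivWithinAt_iff_tendsto_slope' (by simp)).1 (hw.right hξ).1
  have h2 := (hasDerivWithinAt_iff_tendsto_slope' (by simp)).1 (hw.left hξ).1
  rcases lt_trichotomy ρ ξ with h | rfl | h
  · have : leftD w ξ ≤ (w ξ - w ρ) / (ξ - ρ) := by
      refine le_of_tendsto h2 ?_
      filter_upwards [Ioo_mem_nhdsLT h] with s hs
      rw [slope_def_field, ← neg_div_neg_eq, neg_sub, neg_sub]
      have := hw.concaveOn.slope_anti_adjacent (x := ρ) (y := s) (z := ξ) hρ hξ hs.1 hs.2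
      have ha : 0 < ξ - s := sub_pos.2 hs.2
      have hb : 0 < s - ρ := sub_pos.2 hs.1
      rw [div_le_div_iff₀ ha hb] at this
      rw [div_le_div_iff₀ ha (by linarith)]
      nlinarith
    rw [le_div_iff₀ (by linarith)] at this
    nlinarith
  · simp
  · have : (w ρ - w ξ) / (ρ - ξ) ≤ rightD w ξ := by
      refine ge_of_tendsto h1 ?_
      filter_upwards [Ioo_mem_nhdsGT h] with s hs
      rw [slope_def_field]
      have := hw.concaveOn.slope_anti_adjacent (x := ξ) (y := s) (z := ρ) hξ hρ hs.1 hs.2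
      have ha : 0 < ρ - s := sub_pos.2 hs.2
      have hb : 0 < s - ξ := sub_pos.2 hs.1
      rw [div_le_div_iff₀ ha hb] at this
      rw [div_le_div_iff₀ (by linarith) hb]
      nlinarith
    rw [div_le_iff₀ (by linarith)] at this
    nlinarith

/-- If the increments of a `C²` function are dominated on both sides of `ξ` by those of `w`, and its
slope is the one-sided slope of `w` on both sides, then its second derivative is at most `w''`. -/
lemma le_secondD (hw : IsMOC w) (hξ : 0 < ξ) {f f' : ℝ → ℝ} {A : ℝ}
    (hf : ∀ s, HasDerivAt f (f' s) s) (hA : HasDerivAt f' A 0) (hr : f' 0 = rightD w ξ)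
    (hl : f' 0 = leftD w ξ) (hle : ∀ s, 0 < ξ + s → f s - f 0 ≤ w (ξ + s) - w ξ) :
    A ≤ secondD w ξ := by
  have hcw : ContinuousAt w ξ := hw.continuousOn.continuousAt (Ioi_mem_nhds hξ)
  refine le_min ?_ ?_
  · obtain ⟨-, h2, h3⟩ := hw.left hξ
    have ht : Tendsto (fun s : ℝ => ξ - s) (𝓝[>] 0) (𝓝[<] ξ) := by
      refine tendsto_nhdsWithin_iff.2 ⟨?_, ?_⟩
      · have : Tendsto (fun s : ℝ => ξ - s) (𝓝 0) (𝓝 (ξ - 0)) :=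
          (by fun_prop : Continuous fun s : ℝ => ξ - s).tendsto 0
        rw [sub_zero] at this
        exact this.mono_left nhdsWithin_le_nhds
      · filter_upwards [self_mem_nhdsWithin] with s (hs : 0 < s)
        exact sub_lt_self ξ hs
    have := nonneg_of_isMin_of_deriv_eq_zero (g := fun s => w (ξ - s) - f (-s))
      (g' := fun s => -leftD w (ξ - s) + f' (-s)) (A := leftD (leftD w) ξ - A) ?_ ?_ ?_ ?_ ?_
    · linarith
    · refine ContinuousAt.continuousWithinAt (ContinuousAt.sub ?_ ?_)
      · exact ContinuousAt.comp (f := fun s : ℝ => ξ - s) (by simpa using hcw) (by fun_prop)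
      · exact ContinuousAt.comp (f := fun s : ℝ => -s) (by simpa using (hf 0).continuousAt)
          (by fun_prop)
    · filter_upwards [ht.eventually h3] with s hs
      have h4 := hs.comp s ((hasDerivAt_id s).const_sub ξ)
      have h5 := (hf (-s)).comp s (hasDerivAt_id s).neg
      convert! h4.sub h5 using 1
      ring
    · simp only [sub_zero, neg_zero]; linarith
    · have h4 : HasDerivWithinAt (fun s => leftD w (ξ - s)) (leftD (leftD w) ξ * (-1)) (Ioi 0) 0 := by
        refine HasDerivWithinAt.comp (h₂ := leftD w) (h := fun s => ξ - s) (s' := Iio ξ) 0 ?_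
          ((hasDerivAt_id (0 : ℝ)).const_sub ξ).hasDerivWithinAt ?_
        · simpa using h2
        · intro s (hs : 0 < s); exact sub_lt_self ξ hs
      have h5 : HasDerivWithinAt (fun s => f' (-s)) (A * (-1)) (Ioi 0) 0 := by
        refine (HasDerivAt.comp (0 : ℝ) ?_ (hasDerivAt_id (0 : ℝ)).neg).hasDerivWithinAt
        simpa using hA
      convert! h4.neg.add h5 using 1
      ring
    · filter_upwards [Ioo_mem_nhdsGT hξ] with s hs
      have := hle (-s) (by linarith [hs.2])
      simp only [sub_zero, neg_zero]
      rw [← sub_eq_add_neg] at this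
      linarith
  · obtain ⟨-, h2, h3⟩ := hw.right hξ
    have ht : Tendsto (fun s : ℝ => ξ + s) (𝓝[>] 0) (𝓝[>] ξ) := by
      refine tendsto_nhdsWithin_iff.2 ⟨?_, ?_⟩
      · have : Tendsto (fun s : ℝ => ξ + s) (𝓝 0) (𝓝 (ξ + 0)) :=
          (by fun_prop : Continuous fun s : ℝ => ξ + s).tendsto 0
        rw [add_zero] at this
        exact this.mono_left nhdsWithin_le_nhds
      · filter_upwards [self_mem_nhdsWithin] with s (hs : 0 < s)
        exact lt_add_of_pos_right ξ hs
    have := nonneg_of_isMin_of_deriv_eq_zero (g := fun s => w (ξ + s) - f s)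
      (g' := fun s => rightD w (ξ + s) - f' s) (A := rightD (rightD w) ξ - A) ?_ ?_ ?_ ?_ ?_
    · linarith
    · refine ContinuousAt.continuousWithinAt (ContinuousAt.sub ?_ (hf 0).continuousAt)
      exact ContinuousAt.comp (f := fun s : ℝ => ξ + s) (by simpa using hcw) (by fun_prop)
    · filter_upwards [ht.eventually h3] with s hs
      have h4 := hs.comp s ((hasDerivAt_id s).const_add ξ)
      convert! h4.sub (hf s) using 1
      ring
    · simp only [add_zero]; linarith
    · have h4 : HasDerivWithinAt (fun s => rightD w (ξ + s)) (rightD (rightD w) ξ * 1) (Ioi 0) 0 := by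
        refine HasDerivWithinAt.comp (h₂ := rightD w) (h := fun s => ξ + s) (s' := Ioi ξ) 0 ?_
          ((hasDerivAt_id (0 : ℝ)).const_add ξ).hasDerivWithinAt ?_
        · simpa using h2
        · intro s (hs : 0 < s); exact lt_add_of_pos_right ξ hs
      convert! h4.sub hA.hasDerivWithinAt using 1
      ring
    · filter_upwards [self_mem_nhdsWithin] with s (hs : 0 < s)
      have := hle s (by linarith)
      simp only [add_zero]
      linarith

end IsMOC

/-! ### A one-dimensional rearrangement inequality -/

section Rearrangement

variable {W D : ℝ → ℝ} {k : ℝ → ℝ≥0∞} {ξ : ℝ}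

/-- Rearrangement for an odd profile `D` with `D s ≤ W (2 s)`. For `η > ξ/2` the second differences
of `D` are not bounded pointwise by those of the extremal profile `W (2 ·)`, since the deficit
`W (2 s) - D s` at `s = η - ξ/2` enters with the wrong sign; as the kernel is antitone, that
contribution is absorbed by the contributions of the same deficit at `η = |s - ξ/2|`. -/
lemma lintegral_second_difference_le_of_ne_top (hξ : 0 < ξ) (hW : Measurable W) (hD : Measurable D)
    (hk : Measurable k) (hanti : AntitoneOn k (Ioi 0)) (hDW : ∀ s > 0, D s ≤ W (2 * s))
    (hodd : ∀ s, D (-s) = -D s)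
    (hU1 : ∀ η ∈ Ioo 0 (ξ / 2), W (ξ + 2 * η) + W (ξ - 2 * η) - 2 * W ξ ≤ 0)
    (hU2 : ∀ η ∈ Ioi (ξ / 2), W (2 * η + ξ) - W (2 * η - ξ) - 2 * W ξ ≤ 0)
    (hT : ∀ η > 0, D (ξ / 2 + η) + D (ξ / 2 - η) - 2 * W ξ ≤ 0)
    (hfin : ∫⁻ s in Ioi 0, ENNReal.ofReal (W (2 * s) - D s) * k (s + ξ / 2) ≠ ⊤) :
    (∫⁻ η in Ioo 0 (ξ / 2), ENNReal.ofReal (-(W (ξ + 2 * η) + W (ξ - 2 * η) - 2 * W ξ)) * k η) +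
      (∫⁻ η in Ioi (ξ / 2), ENNReal.ofReal (-(W (2 * η + ξ) - W (2 * η - ξ) - 2 * W ξ)) * k η) ≤
    ∫⁻ η in Ioi 0, ENNReal.ofReal (-(D (ξ / 2 + η) + D (ξ / 2 - η) - 2 * W ξ)) * k η := by
  set d : ℝ → ℝ≥0∞ := fun s => ENNReal.ofReal (W (2 * s) - D s) with hd
  have hdm : Measurable d := by fun_prop
  have hξ2 : 0 < ξ / 2 := by linarith
  have hsplit : ∀ g : ℝ → ℝ≥0∞, ∫⁻ η in Ioi 0, g η =
      (∫⁻ η in Ioo 0 (ξ / 2), g η) + ∫⁻ η in Ioi (ξ / 2), g η := by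
    intro g
    rw [← Ioc_union_Ioi_eq_Ioi hξ2.le, lintegral_union measurableSet_Ioi
      (Ioc_disjoint_Ioi le_rfl), setLIntegral_congr Ioo_ae_eq_Ioc]
  have E1 : ∫⁻ η in Ioo 0 (ξ / 2), ENNReal.ofReal
        (-(D (ξ / 2 + η) + D (ξ / 2 - η) - 2 * W ξ)) * k η =
      (∫⁻ η in Ioo 0 (ξ / 2), ENNReal.ofReal
        (-(W (ξ + 2 * η) + W (ξ - 2 * η) - 2 * W ξ)) * k η) +
      ((∫⁻ η in Ioo 0 (ξ / 2), d (η + ξ / 2) * k η) +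
        ∫⁻ η in Ioo 0 (ξ / 2), d (ξ / 2 - η) * k η) := by
    rw [← lintegral_add_left (by fun_prop), ← lintegral_add_left (by fun_prop)]
    refine setLIntegral_congr_fun measurableSet_Ioo fun η hη => ?_
    have h1 := hDW (η + ξ / 2) (by linarith [hη.1])
    have h2 := hDW (ξ / 2 - η) (by linarith [hη.2])
    simp only [hd]
    rw [← add_mul, ← add_mul, ← ENNReal.ofReal_add (by linarith) (by linarith),
      ← ENNReal.ofReal_add (by linarith [hU1 η hη]) (by linarith)]
    congr 2
    rw [show 2 * (η + ξ / 2) = ξ + 2 * η by ring, show 2 * (ξ / 2 - η) = ξ - 2 * η by ring,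
      add_comm η]
    ring
  have E2 : (∫⁻ η in Ioi (ξ / 2), ENNReal.ofReal
        (-(D (ξ / 2 + η) + D (ξ / 2 - η) - 2 * W ξ)) * k η) +
        ∫⁻ η in Ioi (ξ / 2), d (η - ξ / 2) * k η =
      (∫⁻ η in Ioi (ξ / 2), ENNReal.ofReal
        (-(W (2 * η + ξ) - W (2 * η - ξ) - 2 * W ξ)) * k η) +
        ∫⁻ η in Ioi (ξ / 2), d (η + ξ / 2) * k η := by
    rw [← lintegral_add_left (by fun_prop), ← lintegral_add_left (by fun_prop)]
    refine setLIntegral_congr_fun measurableSet_Ioi fun η (hη : ξ / 2 < η) => ?_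
    have h1 := hDW (η + ξ / 2) (by linarith)
    have h2 := hDW (η - ξ / 2) (by linarith)
    simp only [hd]
    rw [← add_mul, ← add_mul, ← ENNReal.ofReal_add (by linarith [hT η (by linarith)]) (by linarith),
      ← ENNReal.ofReal_add (by linarith [hU2 η hη]) (by linarith)]
    congr 2
    have h3 := hodd (η - ξ / 2)
    rw [neg_sub] at h3
    rw [h3, show 2 * (η + ξ / 2) = 2 * η + ξ by ring, show 2 * (η - ξ / 2) = 2 * η - ξ by ring,
      add_comm η]
    ring
  have hB : ∫⁻ η in Ioi (ξ / 2), d (η - ξ / 2) * k η = ∫⁻ s in Ioi 0, d s * k (s + ξ / 2) := by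
    have := (measurePreserving_add_right (volume : Measure ℝ) (ξ / 2)).setLIntegral_comp_preimage
      (s := Ioi (ξ / 2)) measurableSet_Ioi (f := fun η => d (η - ξ / 2) * k η) (by fun_prop)
    rw [← this]
    simp
  have hP : ∫⁻ η in Ioi 0, d (η + ξ / 2) * k η = ∫⁻ s in Ioi (ξ / 2), d s * k (s - ξ / 2) := by
    have := (measurePreserving_add_right (volume : Measure ℝ) (ξ / 2)).setLIntegral_comp_preimage
      (s := Ioi (ξ / 2)) measurableSet_Ioi (f := fun s => d s * k (s - ξ / 2)) (by fun_prop)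
    rw [← this]
    simp
  have hQ : ∫⁻ η in Ioo 0 (ξ / 2), d (ξ / 2 - η) * k η =
      ∫⁻ s in Ioo 0 (ξ / 2), d s * k (ξ / 2 - s) := by
    have := (Measure.measurePreserving_sub_left (volume : Measure ℝ)
      (ξ / 2)).setLIntegral_comp_preimage
      (s := Ioo 0 (ξ / 2)) measurableSet_Ioo (f := fun s => d s * k (ξ / 2 - s)) (by fun_prop)
    rw [← this]
    simp
  -- the wrong-signed deficit term is dominated, since `|s - ξ/2| ≤ s + ξ/2` and `k` is antitone
  have hle : ∫⁻ s in Ioi 0, d s * k (s + ξ / 2) ≤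
      (∫⁻ η in Ioo 0 (ξ / 2), d (ξ / 2 - η) * k η) + ∫⁻ η in Ioi 0, d (η + ξ / 2) * k η := by
    rw [hsplit (fun s => d s * k (s + ξ / 2)), hP, hQ]
    refine add_le_add (setLIntegral_mono' measurableSet_Ioo fun s hs => ?_)
      (setLIntegral_mono' measurableSet_Ioi fun s (hs : ξ / 2 < s) => ?_)
    · gcongr
      exact hanti (by simpa using hs.2) (mem_Ioi.2 (by linarith [hs.1])) (by linarith [hs.1])
    · gcongr
      exact hanti (by simpa using hs) (mem_Ioi.2 (by linarith)) (by linarith)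
  rw [hsplit (fun η => d (η + ξ / 2) * k η)] at hle
  rw [hsplit]
  refine (ENNReal.add_le_add_iff_right hfin).1 ?_
  rw [← hB] at hle ⊢
  refine (add_le_add_right hle _).trans (le_of_eq ?_)
  rw [add_assoc (∫⁻ η in Ioo 0 (ξ / 2), ENNReal.ofReal
        (-(D (ξ / 2 + η) + D (ξ / 2 - η) - 2 * W ξ)) * k η), E2, E1]
  ring

/-- The rearrangement inequality without a finiteness assumption, by truncation of the kernel. -/
lemma lintegral_second_difference_le (hξ : 0 < ξ) (hW : Measurable W) (hD : Measurable D)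
    (hk : Measurable k) (hanti : AntitoneOn k (Ioi 0)) (hktop : ∀ s > 0, k s ≠ ⊤)
    (hmono : MonotoneOn W (Ioi 0)) {C : ℝ} (hC : ∀ s, -C ≤ D s)
    (hDW : ∀ s > 0, D s ≤ W (2 * s)) (hodd : ∀ s, D (-s) = -D s)
    (hU1 : ∀ η ∈ Ioo 0 (ξ / 2), W (ξ + 2 * η) + W (ξ - 2 * η) - 2 * W ξ ≤ 0)
    (hU2 : ∀ η ∈ Ioi (ξ / 2), W (2 * η + ξ) - W (2 * η - ξ) - 2 * W ξ ≤ 0)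
    (hT : ∀ η > 0, D (ξ / 2 + η) + D (ξ / 2 - η) - 2 * W ξ ≤ 0) :
    (∫⁻ η in Ioo 0 (ξ / 2), ENNReal.ofReal (-(W (ξ + 2 * η) + W (ξ - 2 * η) - 2 * W ξ)) * k η) +
      (∫⁻ η in Ioi (ξ / 2), ENNReal.ofReal (-(W (2 * η + ξ) - W (2 * η - ξ) - 2 * W ξ)) * k η) ≤
    ∫⁻ η in Ioi 0, ENNReal.ofReal (-(D (ξ / 2 + η) + D (ξ / 2 - η) - 2 * W ξ)) * k η := by
  set kN : ℕ → ℝ → ℝ≥0∞ := fun N => (Iio (N : ℝ)).indicator k with hkN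
  have hkNm : ∀ N, Measurable (kN N) := fun N => hk.indicator measurableSet_Iio
  have hle : ∀ N s, kN N s ≤ k s := fun N s => indicator_le_self _ _ _
  have hlim : ∀ (g : ℝ → ℝ≥0∞) (S : Set ℝ), Measurable g →
      Tendsto (fun N => ∫⁻ η in S, g η * kN N η) atTop (𝓝 (∫⁻ η in S, g η * k η)) := by
    intro g S hg
    refine lintegral_tendsto_of_tendsto_of_monotone (fun N => (hg.mul (hkNm N)).aemeasurable)
      (ae_of_all _ fun s N M hNM => ?_) (ae_of_all _ fun s => ?_)
    · refine mul_le_mul_right ?_ _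
      exact indicator_le_indicator_of_subset (Iio_subset_Iio (by exact_mod_cast hNM))
        (fun _ => zero_le) s
    · refine tendsto_const_nhds.congr' ?_
      obtain ⟨N, hN⟩ := exists_nat_gt s
      filter_upwards [eventually_ge_atTop N] with M hM
      have : s ∈ Iio (M : ℝ) := hN.trans_le (by exact_mod_cast hM)
      simp only [hkN, indicator_of_mem this]
  refine le_of_tendsto' ((hlim _ _ (by fun_prop)).add (hlim _ _ (by fun_prop))) fun N => ?_
  refine (lintegral_second_difference_le_of_ne_top hξ hW hD (hkNm N) ?_ hDW hodd hU1 hU2 hT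
    ?_).trans (lintegral_mono fun s => mul_le_mul_right (hle N s) _)
  · intro a ha b hb hab
    by_cases hbN : b < N
    · have haN : a < N := hab.trans_lt hbN
      simp only [hkN, indicator_of_mem (mem_Iio.2 hbN), indicator_of_mem (mem_Iio.2 haN)]
      exact hanti ha hb hab
    · simp [hkN, indicator_of_notMem (show b ∉ Iio (N : ℝ) from hbN)]
  · have hb : ∀ s ∈ Ioi (0 : ℝ), ENNReal.ofReal (W (2 * s) - D s) * kN N (s + ξ / 2) ≤
        (Ioo (0 : ℝ) N).indicator
          (fun _ => ENNReal.ofReal (W (2 * N) + C) * k (ξ / 2)) s := by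
      intro s (hs : 0 < s)
      by_cases hsN : s + ξ / 2 < N
      · have hs' : s < N := by linarith
        rw [indicator_of_mem (show s ∈ Ioo (0 : ℝ) N from ⟨hs, hs'⟩)]
        have h1 : W (2 * s) ≤ W (2 * N) :=
          hmono (mem_Ioi.2 (by linarith)) (mem_Ioi.2 (by linarith)) (by linarith)
        gcongr
        · linarith [hC s]
        · exact (hle _ _).trans
            (hanti (mem_Ioi.2 (by linarith)) (mem_Ioi.2 (by linarith)) (by linarith))
      · simp [hkN, indicator_of_notMem (show s + ξ / 2 ∉ Iio (N : ℝ) from hsN)]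
    refine ((setLIntegral_mono' measurableSet_Ioi hb).trans_lt ?_).ne
    refine (setLIntegral_le_lintegral _ _).trans_lt ?_
    rw [lintegral_indicator_const measurableSet_Ioo]
    exact ENNReal.mul_lt_top (ENNReal.mul_lt_top ENNReal.ofReal_lt_top (hktop _ (by linarith)).lt_top)
      (by simp)

end Rearrangement

/-! ### Lines in a fixed direction -/

/-- Euclidean space is foliated, with preservation of volume, by the lines in direction `e`. -/
lemma exists_measurePreserving_lines {m : ℕ} (e : E (m + 1)) (he : ‖e‖ = 1) :
    ∃ L : (Fin m → ℝ) → E (m + 1), Continuous L ∧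
      (∀ (η : ℝ) z, ‖η • e + L z‖ = √(η ^ 2 + ∑ i, z i ^ 2)) ∧
      MeasurePreserving (fun p : ℝ × (Fin m → ℝ) => p.1 • e + L p.2) := by
  obtain ⟨b, hb⟩ := Orthonormal.exists_orthonormalBasis_extension_of_card_eq (𝕜 := ℝ)
    (E := E (m + 1)) (ι := Fin (m + 1)) (by simp) (v := fun _ => e) (s := {0}) (by
      rw [orthonormal_subsingleton_iff]; intro; exact he)
  have hb0 : b 0 = e := hb 0 rfl
  have hsum : ∀ (η : ℝ) (z : Fin m → ℝ), b.repr.symm (WithLp.toLp 2 (Fin.cons η z)) =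
      η • e + b.repr.symm (WithLp.toLp 2 (Fin.cons 0 z)) := by
    intro η z
    rw [← b.sum_repr_symm, ← b.sum_repr_symm]
    simp [Fin.sum_univ_succ, hb0]
  have hcons : Continuous fun p : ℝ × (Fin m → ℝ) => (Fin.cons p.1 p.2 : Fin (m + 1) → ℝ) := by
    refine continuous_pi fun i => ?_
    refine Fin.cases ?_ (fun j => ?_) i
    · simpa using continuous_fst
    · simp only [Fin.cons_succ]; fun_prop
  refine ⟨fun z => b.repr.symm (WithLp.toLp 2 (Fin.cons 0 z)), ?_, fun η z => ?_, ?_⟩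
  · exact b.repr.symm.continuous.comp ((PiLp.continuous_toLp 2 _).comp
      (hcons.comp (by fun_prop : Continuous fun z : Fin m → ℝ => ((0 : ℝ), z))))
  · rw [← hsum, LinearIsometryEquiv.norm_map, EuclideanSpace.norm_eq]
    simp [Fin.sum_univ_succ]
  · have h1 := (volume_preserving_piFinSuccAbove (fun _ : Fin (m + 1) => ℝ) 0).symm
    have h2 := (b.measurePreserving_repr_symm.comp (PiLp.volume_preserving_toLp _)).comp h1
    have heq : (fun p : ℝ × (Fin m → ℝ) =>
        p.1 • e + b.repr.symm (WithLp.toLp 2 (Fin.cons 0 p.2))) =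
        (b.repr.symm ∘ WithLp.toLp 2) ∘
          (MeasurableEquiv.piFinSuccAbove (fun _ : Fin (m + 1) => ℝ) 0).symm := by
      funext p
      rw [← hsum]
      simp [MeasurableEquiv.piFinSuccAbove, Fin.insertNthEquiv]
    rw [heq]
    exact h2

/-- The volume `2^m` of a cube of side two in the directions transversal to a line in `ℝ^{m+1}`, times the
least value of the kernel `|z|^{-(m+1+β)}` on that cube at height one above its centre. -/
noncomputable def lineConst (m : ℕ) (β : ℝ) : ℝ := 2 ^ m * √(m + 1) ^ (-((m + 1 : ℝ) + β))

lemma lineConst_pos (m : ℕ) (β : ℝ) : 0 < lineConst m β := by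
  have hm : (0 : ℝ) < √(m + 1) := Real.sqrt_pos.2 (by positivity)
  unfold lineConst; positivity

/-- The transversal integral of the kernel `|z|^{-(n+β)}` dominates a multiple of the kernel
`η^{-(1+β)}` of the line, as one sees on the cube of side `2η`. -/
lemma le_lintegral_kernel {m : ℕ} {β : ℝ} (hβ : 0 < β) {η : ℝ} (hη : 0 < η) :
    ENNReal.ofReal (lineConst m β) * ENNReal.ofReal (η ^ (-(1 + β))) ≤
      ∫⁻ z : Fin m → ℝ, ENNReal.ofReal (√(η ^ 2 + ∑ i, z i ^ 2) ^ (-((m + 1 : ℝ) + β))) := by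
  unfold lineConst
  have hm : (0 : ℝ) < √(m + 1) := Real.sqrt_pos.2 (by positivity)
  set B : Set (Fin m → ℝ) := Icc (fun _ => -η) (fun _ => η) with hB
  have hvol : volume B = ENNReal.ofReal ((2 * η) ^ m) := by
    rw [hB, Real.volume_Icc_pi]
    simp only [sub_neg_eq_add, Finset.prod_const, Finset.card_univ, Fintype.card_fin]
    rw [← ENNReal.ofReal_pow (by linarith)]
    ring_nf
  have hle : ∀ z ∈ B, ENNReal.ofReal ((√(m + 1) * η) ^ (-((m + 1 : ℝ) + β))) ≤
      ENNReal.ofReal (√(η ^ 2 + ∑ i, z i ^ 2) ^ (-((m + 1 : ℝ) + β))) := by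
    intro z hz
    have hpos : 0 < √(η ^ 2 + ∑ i, z i ^ 2) :=
      Real.sqrt_pos.2 (add_pos_of_pos_of_nonneg (by positivity)
        (Finset.sum_nonneg fun i _ => sq_nonneg _))
    refine ENNReal.ofReal_le_ofReal (Real.rpow_le_rpow_of_nonpos hpos ?_ (by
      have : (0 : ℝ) ≤ m := Nat.cast_nonneg m
      linarith))
    rw [Real.sqrt_le_left (by positivity), mul_pow, Real.sq_sqrt (by positivity)]
    have : ∑ i, z i ^ 2 ≤ ∑ _i : Fin m, η ^ 2 := Finset.sum_le_sum fun i _ =>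
      sq_le_sq' (hz.1 i) (hz.2 i)
    simp only [Finset.sum_const, Finset.card_univ, Fintype.card_fin, nsmul_eq_mul] at this
    linarith
  refine le_trans ?_ (setLIntegral_le_lintegral B _)
  refine le_trans ?_ (setLIntegral_mono' measurableSet_Icc hle)
  rw [setLIntegral_const, hvol, ← ENNReal.ofReal_mul (by positivity),
    ← ENNReal.ofReal_mul (by positivity)]
  refine ENNReal.ofReal_le_ofReal (le_of_eq ?_)
  rw [Real.mul_rpow hm.le hη.le, mul_pow, ← Real.rpow_natCast η m]
  have : η ^ (-(1 + β)) = η ^ (-((m + 1 : ℝ) + β)) * η ^ (m : ℝ) := by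
    rw [← Real.rpow_add hη]; congr 1; ring
  rw [this]; ring

/-- Integrated form of `le_lintegral_kernel`, with the integral over the line taken first. -/
lemma lineConst_mul_lintegral_le {m : ℕ} {β : ℝ} (hβ : 0 < β) {g : ℝ → ℝ≥0∞} (hg : Measurable g)
    {S : Set ℝ} (hS : MeasurableSet S) (hpos : S ⊆ Ioi 0) :
    ENNReal.ofReal (lineConst m β) * ∫⁻ η in S, g η * ENNReal.ofReal (η ^ (-(1 + β))) ≤
      ∫⁻ z : Fin m → ℝ, ∫⁻ η in S, g η *
        ENNReal.ofReal (√(η ^ 2 + ∑ i, z i ^ 2) ^ (-((m + 1 : ℝ) + β))) := by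
  rw [lintegral_lintegral_swap (by fun_prop), ← lintegral_const_mul _ (by fun_prop)]
  refine setLIntegral_mono' hS fun η hη => ?_
  rw [lintegral_const_mul _ (by fun_prop)]
  calc _ = g η * (ENNReal.ofReal (lineConst m β) * ENNReal.ofReal (η ^ (-(1 + β)))) := by ring
    _ ≤ _ := by gcongr; exact le_lintegral_kernel hβ (hpos hη)

/-! ### Second differences of functions with a modulus of continuity -/

/-- The second difference of `f` at `x` with increment `z`. -/
def secondDiff {n : ℕ} (f : E n → ℝ) (x z : E n) : ℝ := f (x + z) + f (x - z) - 2 * f x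

/-- The dissipation estimate at two points at which a modulus of continuity is attained, for the
kernel `|z|^{-(n+β)}`. -/
lemma lineConst_mul_le_lintegral_secondDiff {m : ℕ} {β : ℝ} (hβ : 0 < β) {f : E (m + 1) → ℝ}
    (hf : Continuous f) {C : ℝ} (hC : ∀ x, |f x| ≤ C) {W : ℝ → ℝ} (hW : Measurable W)
    (hpos : ∀ ξ > 0, 0 < W ξ) (hmono : MonotoneOn W (Ioi 0)) (hconc : ConcaveOn ℝ (Ioi 0) W)
    {y e : E (m + 1)} (he : ‖e‖ = 1) {ξ : ℝ} (hξ : 0 < ξ) (heq : f (y + ξ • e) - f y = W ξ)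
    (hle : ∀ x' y', x' ≠ y' → f x' - f y' ≤ W ‖x' - y'‖) :
    ENNReal.ofReal (lineConst m β) *
      ((∫⁻ η in Ioo 0 (ξ / 2), ENNReal.ofReal (-(W (ξ + 2 * η) + W (ξ - 2 * η) - 2 * W ξ)) *
          ENNReal.ofReal (η ^ (-(1 + β)))) +
        ∫⁻ η in Ioi (ξ / 2), ENNReal.ofReal (-(W (2 * η + ξ) - W (2 * η - ξ) - 2 * W ξ)) *
          ENNReal.ofReal (η ^ (-(1 + β)))) ≤
    ∫⁻ z, ENNReal.ofReal (-(secondDiff f (y + ξ • e) z - secondDiff f y z)) *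
      ENNReal.ofReal (‖z‖ ^ (-((m + 1 : ℝ) + β))) := by
  obtain ⟨L, hLc, hLnorm, hLmp⟩ := exists_measurePreserving_lines e he
  set k : (Fin m → ℝ) → ℝ → ℝ≥0∞ := fun z η =>
    ENNReal.ofReal (√(η ^ 2 + ∑ i, z i ^ 2) ^ (-((m + 1 : ℝ) + β))) with hk
  have hexp : -((m + 1 : ℝ) + β) ≤ 0 := by
    have : (0 : ℝ) ≤ m := Nat.cast_nonneg m
    linarith
  set x := y + ξ • e with hx
  set S : E (m + 1) → ℝ := fun z => secondDiff f x z - secondDiff f y z with hS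
  have hScont : Continuous S := by simp only [hS, secondDiff]; fun_prop
  -- The increments `η e + L z` and `-η e + L z` are paired. About the midpoint `c` of the two points
  -- they produce increments of `f` between mirror points at heights `ξ/2 ± η`, averaged over `± L z`
  -- into the odd function `D z`.
  set c := y + (ξ / 2) • e with hc
  set D : (Fin m → ℝ) → ℝ → ℝ := fun z s =>
    ((f (c + s • e + L z) - f (c - s • e + L z)) +
      (f (c + s • e - L z) - f (c - s • e - L z))) / 2 with hD
  have hpair : ∀ z η, S (η • e + L z) + S ((-η) • e + L z) =
      2 * (D z (ξ / 2 + η) + D z (ξ / 2 - η) - 2 * W ξ) := by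
    intro z η
    rw [← heq]
    simp only [hS, hD, secondDiff]
    rw [show x + (η • e + L z) = c + (ξ / 2 + η) • e + L z by rw [hx, hc]; module,
      show x - (η • e + L z) = c + (ξ / 2 - η) • e - L z by rw [hx, hc]; module,
      show y + (η • e + L z) = c - (ξ / 2 - η) • e + L z by rw [hc]; module,
      show y - (η • e + L z) = c - (ξ / 2 + η) • e - L z by rw [hc]; module,
      show x + ((-η) • e + L z) = c + (ξ / 2 - η) • e + L z by rw [hx, hc]; module,
      show x - ((-η) • e + L z) = c + (ξ / 2 + η) • e - L z by rw [hx, hc]; module,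
      show y + ((-η) • e + L z) = c - (ξ / 2 + η) • e + L z by rw [hc]; module,
      show y - ((-η) • e + L z) = c - (ξ / 2 - η) • e - L z by rw [hc]; module]
    ring
  have hxy : ∀ z, f (x + z) - f (y + z) ≤ W ξ := by
    intro z
    have hn : ‖x + z - (y + z)‖ = ξ := by
      rw [show x + z - (y + z) = ξ • e by rw [hx]; module, norm_smul, he, mul_one,
        Real.norm_of_nonneg hξ.le]
    have := hle (x + z) (y + z) (fun h => by rw [h, sub_self, norm_zero] at hn; linarith)
    rwa [hn] at this
  have hSneg : ∀ z, S z ≤ 0 := by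
    intro z
    have h1 := hxy z
    have h2 := hxy (-z)
    simp only [← sub_eq_add_neg] at h2
    simp only [hS, secondDiff]
    linarith
  have hDW : ∀ z, ∀ s > 0, D z s ≤ W (2 * s) := by
    intro z s hs
    have hn : ∀ v : E (m + 1), f (c + s • e + v) - f (c - s • e + v) ≤ W (2 * s) := by
      intro v
      have hn : ‖c + s • e + v - (c - s • e + v)‖ = 2 * s := by
        rw [show c + s • e + v - (c - s • e + v) = (2 * s) • e by module, norm_smul, he, mul_one,
          Real.norm_of_nonneg (by linarith)]
      have := hle (c + s • e + v) (c - s • e + v)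
        (fun h => by rw [h, sub_self, norm_zero] at hn; linarith)
      rwa [hn] at this
    have h1 := hn (L z)
    have h2 := hn (-L z)
    simp only [← sub_eq_add_neg] at h2
    simp only [hD]
    linarith
  have hline : ∀ z, (∫⁻ η in Ioo 0 (ξ / 2),
        ENNReal.ofReal (-(W (ξ + 2 * η) + W (ξ - 2 * η) - 2 * W ξ)) * k z η) +
      (∫⁻ η in Ioi (ξ / 2),
        ENNReal.ofReal (-(W (2 * η + ξ) - W (2 * η - ξ) - 2 * W ξ)) * k z η) ≤
      ∫⁻ η, ENNReal.ofReal (-S (η • e + L z)) * k z η := by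
    intro z
    have hsq : 0 ≤ ∑ i, z i ^ 2 := Finset.sum_nonneg fun i _ => sq_nonneg _
    refine (lintegral_second_difference_le (W := W) (D := D z) (C := 2 * C) hξ hW ?_ ?_ ?_ ?_ hmono
      ?_ (hDW z) ?_ ?_ ?_ ?_).trans ?_
    · have : Continuous (D z) := by simp only [hD]; fun_prop
      exact this.measurable
    · simp only [hk]; fun_prop
    · intro a (ha : 0 < a) b hb hab
      refine ENNReal.ofReal_le_ofReal (Real.rpow_le_rpow_of_nonpos
        (Real.sqrt_pos.2 (by positivity)) (Real.sqrt_le_sqrt ?_) hexp)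
      gcongr
    · exact fun _ _ => ENNReal.ofReal_ne_top
    · intro s
      have h1 := fun v => (abs_le.1 (hC v)).1
      have h2 := fun v => (abs_le.1 (hC v)).2
      simp only [hD]
      linarith [h1 (c + s • e + L z), h2 (c - s • e + L z), h1 (c + s • e - L z),
        h2 (c - s • e - L z)]
    · intro s
      simp only [hD, neg_smul, sub_neg_eq_add, ← sub_eq_add_neg]
      ring
    · intro η hη
      have := add_sub_le_two_mul_of_concave hconc (a := ξ) (h := 2 * η) (by linarith [hη.2])
        (by linarith [hη.1])
      linarith
    · intro η (hη : ξ / 2 < η)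
      have h1 := add_le_of_concave_pos hconc hpos (a := 2 * η - ξ) (b := ξ) (by linarith) hξ
      have h2 := add_le_of_concave_pos hconc hpos (a := 2 * η - ξ + ξ) (b := ξ) (by linarith) hξ
      rw [show 2 * η - ξ + ξ + ξ = 2 * η + ξ by ring] at h2
      linarith
    · intro η hη
      have := hpair z η
      linarith [hSneg (η • e + L z), hSneg ((-η) • e + L z)]
    · have hG : Measurable fun η : ℝ => ENNReal.ofReal (-S (η • e + L z)) * k z η := by
        have : Continuous fun η : ℝ => -S (η • e + L z) := by fun_prop
        simp only [hk]
        fun_prop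
      have hrefl : ∫⁻ η in Iio 0, ENNReal.ofReal (-S (η • e + L z)) * k z η =
          ∫⁻ η in Ioi 0, ENNReal.ofReal (-S ((-η) • e + L z)) * k z η := by
        have := (Measure.measurePreserving_neg (volume : Measure ℝ)).setLIntegral_comp_preimage
          (s := Iio 0) measurableSet_Iio hG
        rw [← this]
        simp [hk]
      have hsplit : ∫⁻ η, ENNReal.ofReal (-S (η • e + L z)) * k z η =
          (∫⁻ η in Iio 0, ENNReal.ofReal (-S (η • e + L z)) * k z η) +
          ∫⁻ η in Ioi 0, ENNReal.ofReal (-S (η • e + L z)) * k z η := by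
        rw [← lintegral_add_compl _ measurableSet_Iio, compl_Iio,
          setLIntegral_congr Ioi_ae_eq_Ici.symm]
      rw [hsplit, hrefl, ← lintegral_add_right _ hG]
      refine setLIntegral_mono' measurableSet_Ioi fun η _ => ?_
      rw [← add_mul]
      gcongr
      rw [← ENNReal.ofReal_add (by linarith [hSneg ((-η) • e + L z)])
        (by linarith [hSneg (η • e + L z)])]
      refine ENNReal.ofReal_le_ofReal ?_
      linarith [hpair z η, hSneg (η • e + L z), hSneg ((-η) • e + L z)]
  have hG : Measurable fun z : E (m + 1) => ENNReal.ofReal (-S z) *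
      ENNReal.ofReal (‖z‖ ^ (-((m + 1 : ℝ) + β))) := by
    have := hScont.measurable
    fun_prop
  have hG' := hG.comp hLmp.measurable
  simp only [Function.comp_def] at hG'
  rw [← hLmp.lintegral_comp hG, Measure.volume_eq_prod, lintegral_prod_symm _ hG'.aemeasurable]
  simp only [hLnorm]
  refine le_trans ?_ (lintegral_mono hline)
  rw [lintegral_add_left (by simp only [hk]; fun_prop), mul_add]
  exact add_le_add
    (lineConst_mul_lintegral_le hβ (by fun_prop) measurableSet_Ioo fun η hη => hη.1)
    (lineConst_mul_lintegral_le hβ (by fun_prop) measurableSet_Ioi fun η hη =>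
      (by linarith : (0:ℝ) < ξ / 2).trans hη)

/-! ### The fractional Laplacian -/

/-- Integrability against the singular kernel of functions that are quadratically small at the
origin and grow more slowly than `|z|^β` at infinity. -/
lemma integrable_div_norm_rpow {n : ℕ} (hn : 1 ≤ n) {β : ℝ} (hβ : 0 < β) (hβ2 : β < 2)
    {g : E n → ℝ} (hg : Continuous g) {A : ℝ} (h1 : ∀ z, ‖z‖ ≤ 1 → |g z| ≤ A * ‖z‖ ^ (2 : ℝ))
    (h2 : ∀ z, 1 ≤ ‖z‖ → |g z| ≤ A * ‖z‖ ^ (β / 2)) :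
    Integrable fun z : E n => g z / ‖z‖ ^ ((n : ℝ) + β) := by
  set h : ℝ → ℝ := fun r => if r ≤ 1 then A * r ^ (2 - n - β) else A * r ^ (-n - β / 2) with hh
  have : Nonempty (Fin n) := ⟨⟨0, hn⟩⟩
  have hint : Integrable (fun z : E n => h ‖z‖) := by
    rw [integrable_fun_norm_addHaar, ← Ioc_union_Ioi_eq_Ioi zero_le_one]
    simp only [finrank_euclideanSpace, Fintype.card_fin, smul_eq_mul]
    have hpow : ∀ r : ℝ, 0 < r → r ^ (n - 1) = r ^ ((n : ℝ) - 1) := fun r hr => by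
      rw [← Real.rpow_natCast, Nat.cast_sub hn, Nat.cast_one]
    refine IntegrableOn.union ?_ ?_
    · have : IntegrableOn (fun r : ℝ => A * r ^ (1 - β)) (Ioc 0 1) := by
        refine Integrable.const_mul ?_ A
        have := intervalIntegral.intervalIntegrable_rpow' (a := 0) (b := 1)
          (by linarith : -1 < 1 - β)
        rwa [intervalIntegrable_iff_integrableOn_Ioc_of_le zero_le_one] at this
      refine this.congr_fun (fun r hr => ?_) measurableSet_Ioc
      simp only [hh, if_pos hr.2]
      rw [hpow r hr.1, mul_left_comm, ← Real.rpow_add hr.1]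
      ring_nf
    · have : IntegrableOn (fun r : ℝ => A * r ^ (-1 - β / 2)) (Ioi 1) :=
        (integrableOn_Ioi_rpow_of_lt (by linarith) one_pos).const_mul A
      refine this.congr_fun (fun r (hr : 1 < r) => ?_) measurableSet_Ioi
      simp only [hh, if_neg hr.not_ge]
      rw [hpow r (by linarith), mul_left_comm, ← Real.rpow_add (by linarith)]
      ring_nf
  refine hint.mono' (hg.measurable.div (by fun_prop)).aestronglyMeasurable (ae_of_all _ fun z => ?_)
  rcases eq_or_ne z 0 with rfl | hz
  · have h0 : g 0 = 0 := by simpa using h1 0 (by simp)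
    have hA : 0 ≤ A := by
      obtain ⟨v, hv⟩ : ∃ v : E n, ‖v‖ = 1 := ⟨EuclideanSpace.single ⟨0, hn⟩ 1, by simp⟩
      simpa [hv] using (abs_nonneg _).trans (h1 v hv.le)
    simp only [hh, norm_zero, zero_le_one, if_true, h0, zero_div]
    positivity
  · have hz : 0 < ‖z‖ := norm_pos_iff.2 hz
    rw [Real.norm_eq_abs, abs_div, abs_of_pos (Real.rpow_pos_of_pos hz _)]
    have hzr : 0 < ‖z‖ ^ ((n : ℝ) + β) := Real.rpow_pos_of_pos hz _
    rw [div_le_iff₀ hzr]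
    by_cases hz1 : ‖z‖ ≤ 1
    · simp only [hh, if_pos hz1]
      rw [mul_assoc, ← Real.rpow_add hz]
      convert! h1 z hz1 using 3
      ring
    · simp only [hh, if_neg hz1]
      rw [mul_assoc, ← Real.rpow_add hz]
      convert! h2 z (not_le.1 hz1).le using 3
      ring

/-- Second differences of bounded `C²` functions are globally `O(|z|²)`: near the origin because the
derivative is locally Lipschitz, and away from it by boundedness. -/
lemma secondDiff_le_of_contDiff {n : ℕ} {f : E n → ℝ} (hf : ContDiff ℝ 2 f) {C : ℝ}
    (hC : ∀ x, |f x| ≤ C) (x : E n) : ∃ A ≥ 0, ∀ z, |secondDiff f x z| ≤ A * ‖z‖ ^ 2 := by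
  have hC0 : 0 ≤ C := (abs_nonneg _).trans (hC x)
  obtain ⟨K, t, ht, hK⟩ := (((contDiff_succ_iff_fderiv (n := 1)).1 hf).2.2.contDiffAt
    (x := x)).exists_lipschitzOnWith
  obtain ⟨r, hr, hrt⟩ := Metric.mem_nhds_iff.1 ht
  have hd : Differentiable ℝ f := hf.differentiable (by norm_num)
  refine ⟨2 * K + 4 * C / r ^ 2, by positivity, fun z => ?_⟩
  rcases lt_or_ge ‖z‖ r with hz | hz
  · have hder : ∀ v, HasFDerivAt (secondDiff f x) (fderiv ℝ f (x + v) - fderiv ℝ f (x - v)) v := by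
      intro v
      have h1 := (hd (x + v)).hasFDerivAt.comp v ((hasFDerivAt_id v).const_add x)
      have h2 := (hd (x - v)).hasFDerivAt.comp v ((hasFDerivAt_id v).const_sub x)
      have h3 := (h1.add h2).sub_const (2 * f x)
      convert! h3 using 1
      ext w
      simp [sub_eq_add_neg]
    have hb : ∀ v ∈ Metric.closedBall (0 : E n) ‖z‖,
        ‖fderiv ℝ f (x + v) - fderiv ℝ f (x - v)‖ ≤ 2 * K * ‖z‖ := by
      intro v hv
      rw [mem_closedBall_zero_iff] at hv
      have h1 : x + v ∈ t := hrt (by simpa [Metric.mem_ball, dist_eq_norm] using hv.trans_lt hz)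
      have h2 : x - v ∈ t := hrt (by simpa [Metric.mem_ball, dist_eq_norm] using hv.trans_lt hz)
      have h3 := hK.dist_le_mul _ h1 _ h2
      rw [dist_eq_norm, dist_eq_norm, show x + v - (x - v) = (2 : ℝ) • v by module, norm_smul,
        Real.norm_of_nonneg zero_le_two] at h3
      have : (K : ℝ) * (2 * ‖v‖) ≤ K * (2 * ‖z‖) := by gcongr
      linarith
    have := (convex_closedBall (0 : E n) ‖z‖).norm_image_sub_le_of_norm_hasFDerivWithin_le
      (fun v _ => (hder v).hasFDerivWithinAt) hb (x := 0) (y := z) (by simp) (by simp)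
    have h0 : secondDiff f x 0 = 0 := by simp [secondDiff]; ring
    rw [h0, sub_zero, sub_zero, Real.norm_eq_abs] at this
    have h4 : 0 ≤ 4 * C / r ^ 2 * ‖z‖ ^ 2 := by positivity
    nlinarith
  · have h1 : |secondDiff f x z| ≤ 4 * C := by
      have h1 := fun v => (abs_le.1 (hC v)).1
      have h2 := fun v => (abs_le.1 (hC v)).2
      rw [abs_le]
      simp only [secondDiff]
      constructor <;> linarith [h1 (x + z), h1 (x - z), h1 x, h2 (x + z), h2 (x - z), h2 x]
    have h2 : 1 ≤ ‖z‖ ^ 2 / r ^ 2 := by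
      rw [one_le_div (by positivity)]
      gcongr
    have h3 : 0 ≤ 2 * (K : ℝ) * ‖z‖ ^ 2 := by positivity
    have h4 : 4 * C * 1 ≤ 4 * C * (‖z‖ ^ 2 / r ^ 2) := by gcongr
    calc _ ≤ 4 * C * (‖z‖ ^ 2 / r ^ 2) := by linarith
      _ = 4 * C / r ^ 2 * ‖z‖ ^ 2 := by ring
      _ ≤ _ := by linarith

lemma integrable_secondDiff {n : ℕ} (hn : 1 ≤ n) {β : ℝ} (hβ : 0 < β) (hβ2 : β < 2) {f : E n → ℝ}
    (hf : ContDiff ℝ 2 f) {C : ℝ} (hC : ∀ x, |f x| ≤ C) (x : E n) :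
    Integrable fun z : E n => secondDiff f x z / ‖z‖ ^ ((n : ℝ) + β) := by
  obtain ⟨A, hA0, hA⟩ := secondDiff_le_of_contDiff hf hC x
  have hC0 : 0 ≤ C := (abs_nonneg _).trans (hC x)
  have hfc := hf.continuous
  refine integrable_div_norm_rpow hn hβ hβ2 (by unfold secondDiff; fun_prop) (A := A + 4 * C)
    (fun z _ => ?_) (fun z hz => ?_)
  · refine (hA z).trans ?_
    rw [Real.rpow_two]
    gcongr
    linarith
  · have h1 := fun v => (abs_le.1 (hC v)).1
    have h2 := fun v => (abs_le.1 (hC v)).2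
    have h3 : |secondDiff f x z| ≤ (A + 4 * C) * 1 := by
      rw [abs_le]
      simp only [secondDiff]
      constructor <;> linarith [h1 (x + z), h1 (x - z), h1 x, h2 (x + z), h2 (x - z), h2 x]
    refine h3.trans ?_
    gcongr
    exact Real.one_le_rpow hz (by linarith)

lemma fracLapConst_pos {n : ℕ} (hn : 1 ≤ n) {β : ℝ} (hβ : 0 < β) (hβ2 : β < 2) :
    0 < fracLapConst n β := by
  have h1 : Real.Gamma (-β / 2) ≠ 0 := by
    refine Real.Gamma_ne_zero fun m hm => ?_
    rcases m with _ | m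
    · simp at hm; linarith
    · push_cast at hm
      have : (0 : ℝ) ≤ m := Nat.cast_nonneg m
      linarith
  have h2 : 0 < Real.Gamma ((n + β) / 2) := Real.Gamma_pos_of_pos (by positivity)
  have := Real.pi_pos
  unfold fracLapConst
  positivity

lemma fracLap_eq_secondDiff {n : ℕ} {β : ℝ} (hβ2 : β < 2) (f : E n → ℝ) (x : E n) :
    fracLap β f x =
      -(fracLapConst n β / 2 * ∫ z : E n, secondDiff f x z / ‖z‖ ^ ((n : ℝ) + β)) := by
  rw [fracLap, if_neg hβ2.ne, ← mul_neg, ← integral_neg]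
  congr 2
  funext z
  rw [secondDiff, ← neg_div]
  congr 1
  ring

/-- The constant `c_β` in front of the dissipation term, in dimension `m + 1`. The term is local for
`β = 2` and the constant is irrelevant there. -/
noncomputable def dissipationConst (m : ℕ) (β : ℝ) : ℝ :=
  if β = 2 then 1 else fracLapConst (m + 1) β / 2 * lineConst m β

lemma dissipationConst_pos (m : ℕ) {β : ℝ} (hβ : 0 < β) (hβ2 : β ≤ 2) :
    0 < dissipationConst m β := by
  unfold dissipationConst
  split_ifs with h
  · exact one_pos
  · have := fracLapConst_pos (n := m + 1) (by omega) hβ (lt_of_le_of_ne hβ2 h)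
    have := lineConst_pos m β
    positivity

/-- The dissipation at a pair of points at which `w`, raised by `F₀ ≥ 0`, is attained. Raising the
modulus only increases the dissipation. -/
lemma fracLap_sub_le_Upsilon {m : ℕ} {β : ℝ} (hβ : 0 < β) (hβ2 : β < 2) {f : E (m + 1) → ℝ}
    (hf : ContDiff ℝ 2 f) {C : ℝ} (hC : ∀ x, |f x| ≤ C) {w : ℝ → ℝ} (hw : IsMOC w) {F₀ : ℝ}
    (hF : 0 ≤ F₀) {y e : E (m + 1)} (he : ‖e‖ = 1) {ξ : ℝ} (hξ : 0 < ξ)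
    (heq : f (y + ξ • e) - f y = w ξ + F₀)
    (hle : ∀ x' y', x' ≠ y' → f x' - f y' ≤ w ‖x' - y'‖ + F₀) :
    ((fracLap β f y - fracLap β f (y + ξ • e) : ℝ) : EReal) ≤
      Upsilon (dissipationConst m β) β w ξ := by
  -- `w` is arbitrary on the nonpositive half-line, so it is cut off there to make it measurable
  set W : ℝ → ℝ := (Ioi 0).indicator fun ρ => w ρ + F₀ with hWdef
  have hWeq : ∀ ρ > 0, W ρ = w ρ + F₀ := fun ρ hρ => indicator_of_mem (mem_Ioi.2 hρ) _
  have hWm : Measurable W := by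
    refine measurable_of_restrict_of_restrict_compl (s := Ioi 0) measurableSet_Ioi ?_ ?_
    · have : (Ioi (0 : ℝ)).domRestrict W = (Ioi (0 : ℝ)).domRestrict (fun ρ => w ρ + F₀) := by
        funext ρ; exact hWeq ρ ρ.2
      rw [this]
      exact (hw.continuousOn.add continuousOn_const).domRestrict.measurable
    · have : (Ioi (0 : ℝ))ᶜ.domRestrict W = fun _ => 0 := by
        funext ρ; exact indicator_of_notMem (f := fun ρ => w ρ + F₀) ρ.2
      rw [this]
      exact measurable_const
  have hmain := lineConst_mul_le_lintegral_secondDiff hβ hf.continuous hC hWm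
    (fun ρ hρ => by rw [hWeq ρ hρ]; linarith [hw.pos ρ hρ])
    (fun a ha b hb hab => by
      rw [hWeq a ha, hWeq b hb]; linarith [hw.monotoneOn ha hb hab])
    ((hw.concaveOn.add_const F₀).congr fun ρ hρ => (hWeq ρ hρ).symm) he hξ
    (by rw [hWeq ξ hξ, heq])
    (fun x' y' h => by rw [hWeq _ (norm_pos_iff.2 (sub_ne_zero.2 h))]; exact hle x' y' h)
  set x := y + ξ • e with hx
  set I : ℝ≥0∞ := (∫⁻ η in Ioo 0 (ξ / 2),
      ENNReal.ofReal (-((w (ξ + 2 * η) + w (ξ - 2 * η) - 2 * w ξ) / η ^ (1 + β)))) +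
    ∫⁻ η in Ioi (ξ / 2),
      ENNReal.ofReal (-((w (2 * η + ξ) - w (2 * η - ξ) - 2 * w ξ) / η ^ (1 + β))) with hI
  have hI' : ENNReal.ofReal (lineConst m β) * I ≤
      ∫⁻ z, ENNReal.ofReal (-(secondDiff f x z - secondDiff f y z) /
        ‖z‖ ^ (((m + 1 : ℕ) : ℝ) + β)) := by
    refine le_trans (mul_le_mul_right (add_le_add ?_ ?_) _) (hmain.trans (le_of_eq ?_))
    · refine setLIntegral_mono' measurableSet_Ioo fun η hη => ?_
      rw [← ENNReal.ofReal_mul' (Real.rpow_nonneg hη.1.le _), Real.rpow_neg hη.1.le,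
        ← div_eq_mul_inv, neg_div, hWeq _ (by linarith [hη.1]), hWeq _ (by linarith [hη.2]),
        hWeq _ hξ]
      refine ENNReal.ofReal_le_ofReal (le_of_eq ?_)
      ring
    · refine setLIntegral_mono' measurableSet_Ioi fun η (hη : ξ / 2 < η) => ?_
      have hη0 : 0 < η := by linarith
      rw [← ENNReal.ofReal_mul' (Real.rpow_nonneg hη0.le _), Real.rpow_neg hη0.le,
        ← div_eq_mul_inv, ← neg_div, hWeq _ (by linarith), hWeq _ (by linarith), hWeq _ hξ]
      have := Real.rpow_pos_of_pos hη0 (1 + β)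
      refine ENNReal.ofReal_le_ofReal ?_
      exact div_le_div_of_nonneg_right (by linarith) this.le
    · refine lintegral_congr fun z => ?_
      rw [← ENNReal.ofReal_mul' (Real.rpow_nonneg (norm_nonneg z) _),
        Real.rpow_neg (norm_nonneg z), ← div_eq_mul_inv]
      push_cast
      rfl
  have hix := integrable_secondDiff (n := m + 1) (by omega) hβ hβ2 hf hC x
  have hiy := integrable_secondDiff (n := m + 1) (by omega) hβ hβ2 hf hC y
  set G : E (m + 1) → ℝ := fun z => -(secondDiff f x z - secondDiff f y z) /
        ‖z‖ ^ (((m + 1 : ℕ) : ℝ) + β) with hG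
  have hGeq : G = fun z => secondDiff f y z / ‖z‖ ^ (((m + 1 : ℕ) : ℝ) + β) -
      secondDiff f x z / ‖z‖ ^ (((m + 1 : ℕ) : ℝ) + β) := by
    funext z; simp only [hG]; ring
  have hGi : Integrable G := by rw [hGeq]; exact hiy.sub hix
  have hG0 : ∀ z, 0 ≤ G z := by
    have hxy : ∀ z, f (x + z) - f (y + z) ≤ w ξ + F₀ := by
      intro z
      have hn : ‖x + z - (y + z)‖ = ξ := by
        rw [show x + z - (y + z) = ξ • e by rw [hx]; module, norm_smul, he, mul_one,
          Real.norm_of_nonneg hξ.le]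
      have := hle (x + z) (y + z) (fun h => by rw [h, sub_self, norm_zero] at hn; linarith)
      rwa [hn] at this
    intro z
    refine div_nonneg ?_ (Real.rpow_nonneg (norm_nonneg _) _)
    have h1 := hxy z
    have h2 := hxy (-z)
    simp only [← sub_eq_add_neg] at h2
    simp only [secondDiff]
    linarith
  have hc : 0 < fracLapConst (m + 1) β := fracLapConst_pos (by omega) hβ hβ2
  have hlap : fracLap β f y - fracLap β f x = -(fracLapConst (m + 1) β / 2 * ∫ z, G z) := by
    rw [fracLap_eq_secondDiff hβ2, fracLap_eq_secondDiff hβ2, hGeq, integral_sub hiy hix]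
    ring
  rw [hlap, Upsilon, if_neg hβ2.ne, EReal.coe_neg, EReal.neg_le_neg_iff, dissipationConst,
    if_neg hβ2.ne, ← hI, ENNReal.ofReal_mul (by positivity), mul_assoc]
  have hfin : ENNReal.ofReal (fracLapConst (m + 1) β / 2) * ∫⁻ z, ENNReal.ofReal (G z) =
      ENNReal.ofReal (fracLapConst (m + 1) β / 2 * ∫ z, G z) := by
    rw [ENNReal.ofReal_mul (by positivity), ofReal_integral_eq_lintegral_ofReal hGi (ae_of_all _ hG0)]
  have hfinal := (mul_le_mul_right hI' (ENNReal.ofReal (fracLapConst (m + 1) β / 2))).trans hfin.le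
  refine (EReal.coe_ennreal_le_coe_ennreal_iff.2 hfinal).trans (le_of_eq ?_)
  rw [EReal.coe_ennreal_ofReal, max_eq_left]
  exact mul_nonneg (by positivity) (integral_nonneg hG0)

/-! ### Derivatives along lines and at maxima -/

section Calculus

variable {n : ℕ} {f : E n → ℝ}

lemma hasDerivAt_along (hf : ContDiff ℝ 2 f) (x v : E n) (s : ℝ) :
    HasDerivAt (fun s : ℝ => f (x + s • v)) (fderiv ℝ f (x + s • v) v) s := by
  have h1 : HasDerivAt (fun s : ℝ => x + s • v) v s := by
    simpa using ((hasDerivAt_id s).smul_const v).const_add x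
  exact (hf.differentiable (by norm_num) (x + s • v)).hasFDerivAt.comp_hasDerivAt s h1

lemma hasDerivAt_fderiv_along (hf : ContDiff ℝ 2 f) (x v : E n) :
    HasDerivAt (fun s : ℝ => fderiv ℝ f (x + s • v) v) (iteratedFDeriv ℝ 2 f x ![v, v]) 0 := by
  have h1 : HasDerivAt (fun s : ℝ => x + s • v) v 0 := by
    simpa using ((hasDerivAt_id (0 : ℝ)).smul_const v).const_add x
  have h2 : Differentiable ℝ (fderiv ℝ f) :=
    ((contDiff_succ_iff_fderiv (n := 1)).1 hf).2.2.differentiable (by norm_num)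
  have h3 : HasFDerivAt (fderiv ℝ f) (fderiv ℝ (fderiv ℝ f) x) (x + (0 : ℝ) • v) := by
    simpa using (h2 x).hasFDerivAt
  rw [iteratedFDeriv_two_apply]
  exact (ContinuousLinearMap.apply ℝ ℝ v).hasFDerivAt.comp_hasDerivAt 0 (h3.comp_hasDerivAt 0 h1)

lemma laplacian_eq_sum (b : OrthonormalBasis (Fin n) ℝ (E n)) (f : E n → ℝ) (x : E n) :
    Laplacian.laplacian f x = ∑ i, iteratedFDeriv ℝ 2 f x ![b i, b i] := by
  rw [InnerProductSpace.laplacian_eq_iteratedFDeriv_orthonormalBasis f b]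

/-- A one-sided derivative from the left at a maximum is nonnegative. -/
lemma nonneg_of_hasDerivWithinAt_Iio {g : ℝ → ℝ} {a t : ℝ} (hg : HasDerivWithinAt g a (Iio t) t)
    (hle : ∀ᶠ s in 𝓝[<] t, g s ≤ g t) : 0 ≤ a := by
  refine ge_of_tendsto ((hasDerivWithinAt_iff_tendsto_slope' (by simp)).1 hg) ?_
  filter_upwards [hle, self_mem_nhdsWithin] with s hs (hst : s < t)
  rw [slope_def_field]
  exact div_nonneg_of_nonpos (by linarith) (by linarith)

lemma abs_le_supNorm {C : ℝ} (hC : ∀ x, |f x| ≤ C) (x : E n) : |f x| ≤ supNorm f :=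
  le_ciSup (f := fun x => |f x|) ⟨C, by rintro _ ⟨y, rfl⟩; exact hC y⟩ x

end Calculus

/-! ### The maximum principle -/

/-- The weight `log (1 + |x|²)`: it tends to infinity, its gradient is `O(1 / (1 + |x|))`, which
compensates a drift of linear growth, and its second differences are bounded by `2 log (1 + |z|²)`. -/
noncomputable def logWeight {n : ℕ} (x : E n) : ℝ := Real.log (1 + ‖x‖ ^ 2)

section LogWeight

variable {n : ℕ}

lemma logWeight_nonneg (x : E n) : 0 ≤ logWeight x :=
  Real.log_nonneg (by nlinarith [sq_nonneg ‖x‖])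

lemma continuous_logWeight : Continuous (logWeight : E n → ℝ) := by
  unfold logWeight
  exact Continuous.log (by fun_prop) fun x => by positivity

lemma le_logWeight {a : ℝ} {x : E n} (h : Real.exp a ≤ ‖x‖) : a ≤ logWeight x := by
  rw [logWeight, Real.le_log_iff_exp_le (by positivity)]
  nlinarith [sq_nonneg (‖x‖ - 1)]

lemma secondDiff_logWeight_le (x z : E n) :
    secondDiff logWeight x z ≤ 2 * Real.log (1 + ‖z‖ ^ 2) := by
  have h1 : ‖x + z‖ ^ 2 = ‖x‖ ^ 2 + 2 * inner ℝ x z + ‖z‖ ^ 2 := norm_add_sq_real x z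
  have h2 : ‖x - z‖ ^ 2 = ‖x‖ ^ 2 - 2 * inner ℝ x z + ‖z‖ ^ 2 := norm_sub_sq_real x z
  have hp : (1 + ‖x + z‖ ^ 2) * (1 + ‖x - z‖ ^ 2) ≤ ((1 + ‖x‖ ^ 2) * (1 + ‖z‖ ^ 2)) ^ 2 := by
    have hle : 1 + ‖x‖ ^ 2 + ‖z‖ ^ 2 ≤ (1 + ‖x‖ ^ 2) * (1 + ‖z‖ ^ 2) := by
      nlinarith [mul_nonneg (sq_nonneg ‖x‖) (sq_nonneg ‖z‖)]
    have := pow_le_pow_left₀ (by positivity) hle 2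
    rw [h1, h2]
    nlinarith [sq_nonneg (inner ℝ x z)]
  have := Real.log_le_log (by positivity) hp
  rw [Real.log_mul (by positivity) (by positivity), Real.log_pow,
    Real.log_mul (by positivity) (by positivity)] at this
  simp only [secondDiff, logWeight]
  push_cast at this
  linarith

lemma hasDerivAt_logWeight_along (x v : E n) :
    HasDerivAt (fun s : ℝ => logWeight (x + s • v)) (2 * inner ℝ x v / (1 + ‖x‖ ^ 2)) 0 := by
  have h1 : HasDerivAt (fun s : ℝ => x + s • v) v 0 := by
    simpa using ((hasDerivAt_id (0 : ℝ)).smul_const v).const_add x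
  have h2 := (h1.norm_sq.const_add 1).log (by positivity)
  simp only [zero_smul, add_zero] at h2
  exact h2

end LogWeight

section Barrier

variable {n : ℕ} {f : E n → ℝ} {x : E n} {δ : ℝ}

lemma fderiv_eq_of_le_logWeight (hf : ContDiff ℝ 2 f)
    (hmax : ∀ x', f x' - f x ≤ δ * (logWeight x' - logWeight x)) (v : E n) :
    fderiv ℝ f x v = δ * (2 * inner ℝ x v / (1 + ‖x‖ ^ 2)) := by
  have h1 := hasDerivAt_along hf x v 0
  have h2 := (hasDerivAt_logWeight_along x v).const_mul δ
  have hm : IsLocalMax (fun s : ℝ => f (x + s • v) - δ * logWeight (x + s • v)) 0 := by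
    refine Eventually.of_forall fun s => ?_
    have := hmax (x + s • v)
    simp only [zero_smul, add_zero]
    linarith
  have := hm.hasDerivAt_eq_zero (h1.sub h2)
  simp only [zero_smul, add_zero] at this
  linarith

lemma secondDiff_le_of_le_logWeight (hδ : 0 ≤ δ)
    (hmax : ∀ x', f x' - f x ≤ δ * (logWeight x' - logWeight x)) (z : E n) :
    secondDiff f x z ≤ δ * (2 * Real.log (1 + ‖z‖ ^ 2)) := by
  have h1 := hmax (x + z)
  have h2 := hmax (x - z)
  have h3 := mul_le_mul_of_nonneg_left (secondDiff_logWeight_le x z) hδ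
  simp only [secondDiff] at h3 ⊢
  linarith

/-- At a maximum of `f - δ logWeight` every pure second derivative of `f` is at most `2δ`, since second
differences of the weight are at most `2 log (1 + s²) ≤ 2 s²`. -/
lemma laplacian_le_of_le_logWeight (hf : ContDiff ℝ 2 f) (hδ : 0 ≤ δ)
    (hmax : ∀ x', f x' - f x ≤ δ * (logWeight x' - logWeight x)) :
    Laplacian.laplacian f x ≤ δ * (2 * n) := by
  set b := EuclideanSpace.basisFun (Fin n) ℝ
  have hle : ∀ i, iteratedFDeriv ℝ 2 f x ![b i, b i] ≤ 2 * δ := by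
    intro i
    set v := b i with hv
    have hv1 : ‖v‖ = 1 := b.orthonormal.1 i
    have h1 := fun s => hasDerivAt_along hf x v s
    have h2 : ∀ s, HasDerivAt (fun s : ℝ => f (x + (-s) • v))
        (-fderiv ℝ f (x + (-s) • v) v) s := by
      intro s
      have := (h1 (-s)).scomp s (hasDerivAt_neg s)
      rwa [neg_one_smul] at this
    have h3 := hasDerivAt_fderiv_along hf x v
    have h4 : HasDerivAt (fun s : ℝ => -fderiv ℝ f (x + (-s) • v) v)
        (iteratedFDeriv ℝ 2 f x ![v, v]) 0 := by
      have h3' : HasDerivAt (fun s : ℝ => fderiv ℝ f (x + s • v) v)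
        (iteratedFDeriv ℝ 2 f x ![v, v]) (-0) := by simpa using h3
      have := (h3'.scomp 0 (hasDerivAt_neg (0 : ℝ))).neg
      rwa [neg_one_smul, neg_neg] at this
    have := nonneg_of_isMin_of_hasDerivAt
      (g := fun s => 2 * δ * s ^ 2 - (f (x + s • v) + f (x + (-s) • v)))
      (g' := fun s => 2 * δ * (2 * s) - (fderiv ℝ f (x + s • v) v + -fderiv ℝ f (x + (-s) • v) v))
      (A := 2 * δ * 2 - (iteratedFDeriv ℝ 2 f x ![v, v] + iteratedFDeriv ℝ 2 f x ![v, v]))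
      (fun s => ?_) ?_ ?_ ?_
    · linarith
    · have := ((hasDerivAt_pow 2 s).const_mul (2 * δ)).sub ((h1 s).add (h2 s))
      convert! this using 1
      ring
    · simp
    · have := (((hasDerivAt_id (0 : ℝ)).const_mul 2).const_mul (2 * δ)).sub (h3.add h4)
      convert! this using 1
      ring
    · intro s
      have h5 := secondDiff_le_of_le_logWeight hδ hmax (s • v)
      rw [norm_smul, hv1, mul_one, Real.norm_eq_abs, sq_abs] at h5
      have h6 : Real.log (1 + s ^ 2) ≤ s ^ 2 := by
        have := Real.log_le_sub_one_of_pos (by positivity : 0 < 1 + s ^ 2)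
        linarith
      have h7 := mul_le_mul_of_nonneg_left h6 hδ
      simp only [secondDiff] at h5
      simp only [neg_smul, ← sub_eq_add_neg, zero_smul, add_zero, sub_zero]
      linarith
  rw [laplacian_eq_sum b]
  refine (Finset.sum_le_sum fun i _ => hle i).trans (le_of_eq ?_)
  simp
  ring

lemma integrable_log_div (hn : 1 ≤ n) {β : ℝ} (hβ : 0 < β) (hβ2 : β < 2) :
    Integrable fun z : E n => Real.log (1 + ‖z‖ ^ 2) / ‖z‖ ^ ((n : ℝ) + β) := by
  refine integrable_div_norm_rpow hn hβ hβ2 (continuous_logWeight (n := n))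
    (A := 1 + 2 ^ (β / 4) / (β / 4)) (fun z _ => ?_) (fun z hz => ?_)
  · rw [abs_of_nonneg (Real.log_nonneg (by nlinarith [sq_nonneg ‖z‖])), Real.rpow_two]
    have h1 := Real.log_le_sub_one_of_pos (by positivity : 0 < 1 + ‖z‖ ^ 2)
    have h2 : 0 ≤ 2 ^ (β / 4) / (β / 4) * ‖z‖ ^ 2 := by positivity
    linarith
  · rw [abs_of_nonneg (Real.log_nonneg (by nlinarith [sq_nonneg ‖z‖]))]
    have h1 := Real.log_le_rpow_div (by positivity : 0 ≤ 1 + ‖z‖ ^ 2) (by positivity : 0 < β / 4)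
    have h2 : (1 + ‖z‖ ^ 2) ^ (β / 4) ≤ (2 * ‖z‖ ^ 2) ^ (β / 4) := by
      gcongr
      nlinarith
    have h3 : (2 * ‖z‖ ^ 2) ^ (β / 4) = 2 ^ (β / 4) * ‖z‖ ^ (β / 2) := by
      rw [Real.mul_rpow zero_le_two (by positivity), ← Real.rpow_natCast, ← Real.rpow_mul
        (norm_nonneg z)]
      congr 2
      push_cast
      ring
    have h4 : 0 ≤ ‖z‖ ^ (β / 2) := by positivity
    calc _ ≤ (1 + ‖z‖ ^ 2) ^ (β / 4) / (β / 4) := h1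
      _ ≤ 2 ^ (β / 4) * ‖z‖ ^ (β / 2) / (β / 4) := by gcongr; rw [← h3]; exact h2
      _ = 2 ^ (β / 4) / (β / 4) * ‖z‖ ^ (β / 2) := by ring
      _ ≤ _ := by linarith

/-- `Λ^β f` is bounded from below by a fixed multiple of `-δ` at a maximum of `f - δ logWeight`. -/
lemma exists_neg_fracLap_le_of_le_logWeight (hn : 1 ≤ n) {β : ℝ} (hβ : 0 < β) (hβ2 : β ≤ 2) :
    ∃ Q : ℝ, ∀ (f : E n → ℝ) (x : E n) (δ : ℝ), ContDiff ℝ 2 f → 0 ≤ δ →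
      (∀ x', f x' - f x ≤ δ * (logWeight x' - logWeight x)) → -fracLap β f x ≤ δ * Q := by
  rcases hβ2.eq_or_lt with rfl | hβ2
  · refine ⟨2 * n, fun f x δ hf hδ hmax => ?_⟩
    rw [fracLap, if_pos rfl, neg_neg]
    exact laplacian_le_of_le_logWeight hf hδ hmax
  · have hc := fracLapConst_pos hn hβ hβ2
    have hI : 0 ≤ ∫ z : E n, Real.log (1 + ‖z‖ ^ 2) / ‖z‖ ^ ((n : ℝ) + β) :=
      integral_nonneg fun z => div_nonneg (Real.log_nonneg (by nlinarith [sq_nonneg ‖z‖]))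
        (Real.rpow_nonneg (norm_nonneg _) _)
    refine ⟨fracLapConst n β * ∫ z : E n, Real.log (1 + ‖z‖ ^ 2) / ‖z‖ ^ ((n : ℝ) + β),
      fun f x δ hf hδ hmax => ?_⟩
    rw [fracLap_eq_secondDiff hβ2, neg_neg]
    have hkey : ∫ z : E n, secondDiff f x z / ‖z‖ ^ ((n : ℝ) + β) ≤
        δ * 2 * ∫ z : E n, Real.log (1 + ‖z‖ ^ 2) / ‖z‖ ^ ((n : ℝ) + β) := by
      -- if the second differences are not integrable, the integral is zero by convention
      by_cases hi : Integrable fun z : E n => secondDiff f x z / ‖z‖ ^ ((n : ℝ) + β)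
      · rw [← integral_const_mul]
        refine integral_mono hi ((integrable_log_div hn hβ hβ2).const_mul _) fun z => ?_
        beta_reduce
        rw [← mul_div_assoc, mul_assoc]
        exact div_le_div_of_nonneg_right (secondDiff_le_of_le_logWeight hδ hmax z)
          (Real.rpow_nonneg (norm_nonneg _) _)
      · rw [integral_undef hi]
        positivity
    calc _ ≤ fracLapConst n β / 2 *
          (δ * 2 * ∫ z : E n, Real.log (1 + ‖z‖ ^ 2) / ‖z‖ ^ ((n : ℝ) + β)) := by gcongr
      _ = _ := by ring

end Barrier

namespace IsSmoothSolution

variable {n : ℕ} {β ν ε T : ℝ} {u : ℝ → E n → E n} {θ : ℝ → E n → ℝ}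

lemma contDiff_space (h : IsSmoothSolution β ν ε T u θ) {t : ℝ} (ht : t ∈ Ioc 0 T) :
    ContDiff ℝ 2 (θ t) := by
  rw [← contDiffOn_univ]
  have h1 : ContDiffOn ℝ 2 (Function.uncurry θ) (Ioc 0 T ×ˢ univ) :=
    h.smooth.of_le (WithTop.coe_le_coe.2 (le_top : (2 : ℕ∞) ≤ ⊤))
  exact h1.comp (f := fun x : E n => (t, x)) (contDiff_const.prodMk contDiff_id).contDiffOn
    fun x _ => ⟨ht, mem_univ _⟩

lemma hasDerivWithinAt_time (h : IsSmoothSolution β ν ε T u θ) {t : ℝ} (ht : t ∈ Ioc 0 T)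
    (x : E n) : HasDerivWithinAt (fun s => θ s x)
      (derivWithin (fun s => θ s x) (Icc 0 T) t) (Iio t) t := by
  have h1 : ContDiffOn ℝ 1 (Function.uncurry θ) (Ioc 0 T ×ˢ univ) :=
    h.smooth.of_le (by exact_mod_cast le_top)
  have h2 : ContDiffOn ℝ 1 (fun s => θ s x) (Ioc 0 T) :=
    h1.comp (f := fun s : ℝ => (s, x)) (contDiff_id.prodMk contDiff_const).contDiffOn
      fun s hs => ⟨hs, mem_univ _⟩
  have h3 : DifferentiableWithinAt ℝ (fun s => θ s x) (Icc 0 T) t := by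
    refine (h2.differentiableOn (by norm_num) t ht).mono_of_mem_nhdsWithin ?_
    filter_upwards [self_mem_nhdsWithin, mem_nhdsWithin_of_mem_nhds (Ioi_mem_nhds ht.1)]
      with s hs hs0
    exact ⟨hs0, hs.2⟩
  refine h3.hasDerivWithinAt.mono_of_mem_nhdsWithin ?_
  filter_upwards [Ioo_mem_nhdsLT ht.1] with s hs
  exact ⟨hs.1.le, hs.2.le.trans ht.2⟩

lemma neg (h : IsSmoothSolution β ν ε T u θ) : IsSmoothSolution β ν ε T u (-θ) where
  smooth := h.smooth.neg
  continuousOn := h.continuousOn.neg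
  initial_C1 := h.initial_C1.neg
  bounded := by
    obtain ⟨C, hC⟩ := h.bounded
    exact ⟨C, fun t ht x => by simpa using hC t ht x⟩
  gradient_continuous := by
    intro t ht e he
    obtain ⟨r, hr, hr'⟩ := h.gradient_continuous t ht e he
    refine ⟨r, hr, fun s hs hst x => ?_⟩
    have hg : ∀ s, gradient ((-θ) s) x = -gradient (θ s) x := fun s => by
      simp [gradient, fderiv_neg]
    rw [hg, hg, ← neg_sub', norm_neg]
    exact hr' s hs hst x
  velocity_growth := h.velocity_growth
  equation := by
    intro t ht x
    have hg : gradient ((-θ) t) x = -gradient (θ t) x := by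
      simp [gradient, fderiv_neg]
    have hl : Laplacian.laplacian ((-θ) t) x = -Laplacian.laplacian (θ t) x := by
      rw [Pi.neg_apply, InnerProductSpace.laplacian_neg]; rfl
    have hd : derivWithin (fun s => (-θ) s x) (Icc 0 T) t =
        -derivWithin (fun s => θ s x) (Icc 0 T) t := derivWithin.fun_neg
    have hf : fracLap β ((-θ) t) x = -fracLap β (θ t) x := by
      unfold fracLap
      split_ifs
      · rw [hl]
      · rw [← mul_neg, ← integral_neg]
        congr 2
        funext z
        rw [← neg_div]
        congr 1
        simp only [Pi.neg_apply]
        ring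
    rw [hg, hl, hd, hf, inner_neg_right]
    linarith [h.equation t ht x]

/-- The maximum principle, by comparison with the barriers `δ (logWeight x + C t)`. -/
lemma le_supNorm (h : IsSmoothSolution β ν ε T u θ) (hn : 1 ≤ n) (hβ : 0 < β) (hβ2 : β ≤ 2)
    (hν : 0 < ν) (hε : 0 ≤ ε) {t : ℝ} (ht : t ∈ Icc 0 T) (x : E n) :
    θ t x ≤ supNorm (θ 0) := by
  obtain ⟨C, hC⟩ := h.bounded
  obtain ⟨K, hK⟩ := h.velocity_growth
  obtain ⟨Q, hQ⟩ := exists_neg_fracLap_le_of_le_logWeight hn hβ hβ2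
  have h0T : (0 : ℝ) ∈ Icc 0 T := ⟨le_rfl, ht.1.trans ht.2⟩
  set B : ℝ := 3 * |K| + ν * Q + ε * (2 * n) with hB
  have hbar : ∀ δ > 0, θ t x ≤ supNorm (θ 0) + δ * (logWeight x + (|B| + 1) * t) := by
    intro δ hδ
    set Ψ : ℝ × E n → ℝ := fun p =>
      Function.uncurry θ p - δ * (logWeight p.2 + (|B| + 1) * p.1) with hΨ
    have hΨc : ContinuousOn Ψ (Icc 0 T ×ˢ univ) := by
      refine h.continuousOn.sub (Continuous.continuousOn ?_)
      have := continuous_logWeight (n := n)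
      fun_prop
    set R := Real.exp (2 * C / δ) with hR
    obtain ⟨p, hp, hmax⟩ := (isCompact_Icc.prod (isCompact_closedBall (0 : E n) R)).exists_isMaxOn
      (s := Icc 0 T ×ˢ Metric.closedBall (0 : E n) R)
      ⟨(0, 0), h0T, by simp [hR, Real.exp_nonneg]⟩
      (hΨc.mono (prod_mono le_rfl (subset_univ _)))
    have hmax' : ∀ s ∈ Icc 0 T, ∀ z, Ψ (s, z) ≤ Ψ p := by
      intro s hs z
      rcases le_or_gt ‖z‖ R with hz | hz
      · exact hmax (show (s, z) ∈ Icc 0 T ×ˢ Metric.closedBall (0 : E n) R from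
          ⟨hs, by simpa using hz⟩)
      · have h1 : Ψ (0, 0) ≤ Ψ p := hmax (show ((0 : ℝ), (0 : E n)) ∈
          Icc 0 T ×ˢ Metric.closedBall (0 : E n) R from ⟨h0T, by simp [hR, Real.exp_nonneg]⟩)
        refine le_trans ?_ h1
        have h2 := le_logWeight hz.le
        have h3 := (abs_le.1 (hC s hs z)).2
        have h4 := (abs_le.1 (hC 0 h0T 0)).1
        rw [div_le_iff₀ hδ] at h2
        have h5 : 0 ≤ δ * ((|B| + 1) * s) := by have := hs.1; positivity
        simp only [hΨ, Function.uncurry, logWeight, norm_zero]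
        simp only [logWeight] at h2
        norm_num
        linarith
    obtain ⟨t₁, x₁⟩ := p
    have ht₁ : t₁ ∈ Icc 0 T := hp.1
    have hfin := hmax' t ht x
    rcases ht₁.1.eq_or_lt with h0 | h0
    · have h1 := (abs_le.1 (abs_le_supNorm (hC 0 h0T) x₁)).2
      have h2 := mul_nonneg hδ.le (logWeight_nonneg x₁)
      simp only [hΨ, Function.uncurry, ← h0] at hfin
      linarith
    · exfalso
      have ht₁' : t₁ ∈ Ioc 0 T := ⟨h0, ht₁.2⟩
      have hf := h.contDiff_space ht₁'
      have hsp : ∀ x', θ t₁ x' - θ t₁ x₁ ≤ δ * (logWeight x' - logWeight x₁) := by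
        intro x'
        have := hmax' t₁ ht₁ x'
        simp only [hΨ, Function.uncurry] at this
        linarith
      have htime : 0 ≤ derivWithin (fun s => θ s x₁) (Icc 0 T) t₁ - δ * (|B| + 1) := by
        have h1 := (h.hasDerivWithinAt_time ht₁' x₁).sub
          ((hasDerivAt_id t₁).const_mul (δ * (|B| + 1))).hasDerivWithinAt
        rw [mul_one] at h1
        refine nonneg_of_hasDerivWithinAt_Iio h1 ?_
        filter_upwards [Ioo_mem_nhdsLT h0] with s hs
        have := hmax' s ⟨hs.1.le, hs.2.le.trans ht₁.2⟩ x₁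
        simp only [hΨ, Function.uncurry] at this
        simp only [Pi.sub_apply, id]
        linarith
      have hlap := laplacian_le_of_le_logWeight hf hδ.le hsp
      have hfrac := hQ _ _ _ hf hδ.le hsp
      have hgrad : -inner ℝ (u t₁ x₁) (gradient (θ t₁) x₁) ≤ δ * (3 * |K|) := by
        rw [real_inner_comm, inner_gradient_left, fderiv_eq_of_le_logWeight hf hsp, ← mul_neg]
        refine mul_le_mul_of_nonneg_left ?_ hδ.le
        rw [← neg_div, div_le_iff₀ (by positivity)]
        have h1 := (abs_le.1 (abs_real_inner_le_norm x₁ (u t₁ x₁))).1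
        have h2 : ‖u t₁ x₁‖ ≤ |K| * (1 + ‖x₁‖) := (hK t₁ ht₁' x₁).trans
          (mul_le_mul_of_nonneg_right (le_abs_self K) (by positivity))
        have h3 : ‖x₁‖ * ‖u t₁ x₁‖ ≤ ‖x₁‖ * (|K| * (1 + ‖x₁‖)) := by gcongr
        have h4 : 0 ≤ |K| * ((‖x₁‖ - 1) ^ 2 + 2) := by positivity
        nlinarith
      have heq := h.equation t₁ ht₁' x₁
      have h1 := mul_le_mul_of_nonneg_left hlap hε
      have h2 := mul_le_mul_of_nonneg_left hfrac hν.le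
      have h3 := mul_le_mul_of_nonneg_left (le_abs_self B) hδ.le
      have h4 : δ * B = δ * (3 * |K|) + ν * (δ * Q) + ε * (δ * (2 * n)) := by rw [hB]; ring
      linarith
  have hlim : Tendsto (fun δ : ℝ => supNorm (θ 0) + δ * (logWeight x + (|B| + 1) * t)) (𝓝[>] 0)
      (𝓝 (supNorm (θ 0) + 0 * (logWeight x + (|B| + 1) * t))) :=
    ((by fun_prop : Continuous fun δ : ℝ => supNorm (θ 0) + δ * (logWeight x + (|B| + 1) * t)).tendsto
      0).mono_left nhdsWithin_le_nhds
  rw [zero_mul, add_zero] at hlim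
  exact ge_of_tendsto hlim (mem_of_superset self_mem_nhdsWithin hbar)

lemma abs_le_supNorm_initial (h : IsSmoothSolution β ν ε T u θ) (hn : 1 ≤ n) (hβ : 0 < β)
    (hβ2 : β ≤ 2) (hν : 0 < ν) (hε : 0 ≤ ε) {t : ℝ} (ht : t ∈ Icc 0 T) (x : E n) :
    |θ t x| ≤ supNorm (θ 0) := by
  refine abs_le'.2 ⟨h.le_supNorm hn hβ hβ2 hν hε ht x, ?_⟩
  have := h.neg.le_supNorm hn hβ hβ2 hν hε ht x
  simpa [supNorm] using this

end IsSmoothSolution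

/-! ### Contact with a modulus of continuity -/

/-- At the points `y + ξ e` and `y` the increment of `f` attains the modulus `w`, raised by `F₀`, and
it exceeds the raised modulus nowhere. -/
structure IsContact {n : ℕ} (f : E n → ℝ) (w : ℝ → ℝ) (F₀ ξ : ℝ) (y e : E n) : Prop where
  norm_eq : ‖e‖ = 1
  pos : 0 < ξ
  eq : f (y + ξ • e) - f y = w ξ + F₀
  le : ∀ x' y', x' ≠ y' → f x' - f y' ≤ w ‖x' - y'‖ + F₀

namespace IsContact

variable {n : ℕ} {f : E n → ℝ} {w : ℝ → ℝ} {F₀ ξ : ℝ} {y e : E n}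

/-- The reflection that exchanges the two points of contact. -/
lemma neg (h : IsContact f w F₀ ξ y e) : IsContact (-f) w F₀ ξ (y + ξ • e) (-e) where
  norm_eq := by rw [norm_neg, h.norm_eq]
  pos := h.pos
  eq := by
    rw [smul_neg, add_neg_cancel_right, Pi.neg_apply, Pi.neg_apply, ← h.eq]
    ring
  le := by
    intro x' y' hne
    have := h.le y' x' hne.symm
    rw [norm_sub_rev] at this
    rw [Pi.neg_apply, Pi.neg_apply]
    linarith

/-- At the outer point of contact the gradient is `m e` for every supergradient `m` of `w`. The
distance to `y` is replaced by the quadratic polynomial `(|·|² + ξ²) / (2ξ)`, which dominates it and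
agrees with it at distance `ξ`. -/
lemma fderiv_eq (h : IsContact f w F₀ ξ y e) (hf : ContDiff ℝ 2 f) (hw : IsMOC w) {m : ℝ}
    (hm1 : rightD w ξ ≤ m) (hm2 : m ≤ leftD w ξ) (v : E n) :
    fderiv ℝ f (y + ξ • e) v = m * inner ℝ e v := by
  have hξ := h.pos
  have hm : 0 ≤ m := (hw.rightD_nonneg hξ).trans hm1
  have hnorm : ‖ξ • e‖ = ξ := by rw [norm_smul, h.norm_eq, mul_one, Real.norm_of_nonneg hξ.le]
  have h1 := hasDerivAt_along hf (y + ξ • e) v 0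
  have h2 : HasDerivAt (fun s : ℝ => ξ • e + s • v) v 0 := by
    simpa using ((hasDerivAt_id (0 : ℝ)).smul_const v).const_add (ξ • e)
  have h3 := ((h2.norm_sq.add_const (ξ ^ 2)).div_const (2 * ξ)).const_mul m
  have hne : ∀ᶠ s : ℝ in 𝓝 0, 0 < ‖ξ • e + s • v‖ := by
    have hc : Continuous fun s : ℝ => ‖ξ • e + s • v‖ := by fun_prop
    refine hc.continuousAt.eventually_mem (Ioi_mem_nhds ?_)
    rw [zero_smul, add_zero, hnorm]
    exact hξ
  have hmax : IsLocalMax (fun s : ℝ => f (y + ξ • e + s • v) -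
      m * ((‖ξ • e + s • v‖ ^ 2 + ξ ^ 2) / (2 * ξ))) 0 := by
    filter_upwards [hne] with s hs
    have hne' : y + ξ • e + s • v ≠ y := by
      intro h0
      rw [add_assoc, add_eq_left] at h0
      rw [h0, norm_zero] at hs
      exact hs.false
    have h4 := h.le _ _ hne'
    rw [show y + ξ • e + s • v - y = ξ • e + s • v by module] at h4
    have h5 := hw.le_add_mul hξ hm1 hm2 hs
    have h6 : ‖ξ • e + s • v‖ ≤ (‖ξ • e + s • v‖ ^ 2 + ξ ^ 2) / (2 * ξ) := by
      rw [le_div_iff₀ (by linarith)]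
      nlinarith [sq_nonneg (‖ξ • e + s • v‖ - ξ)]
    have h7 := mul_le_mul_of_nonneg_left h6 hm
    have h8 : (ξ ^ 2 + ξ ^ 2) / (2 * ξ) = ξ := by field_simp; ring
    simp only [zero_smul, add_zero, hnorm, h8]
    linarith [h.eq]
  have h9 := hmax.hasDerivAt_eq_zero (h1.sub h3)
  simp only [zero_smul, add_zero, real_inner_smul_left] at h9
  have h10 : m * (2 * (ξ * inner ℝ e v) / (2 * ξ)) = m * inner ℝ e v := by field_simp
  linarith

/-- The same gradient is found at the inner point of contact. -/
lemma fderiv_eq' (h : IsContact f w F₀ ξ y e) (hf : ContDiff ℝ 2 f) (hw : IsMOC w) {m : ℝ}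
    (hm1 : rightD w ξ ≤ m) (hm2 : m ≤ leftD w ξ) (v : E n) :
    fderiv ℝ f y v = m * inner ℝ e v := by
  have := h.neg.fderiv_eq hf.neg hw hm1 hm2 v
  rw [smul_neg, add_neg_cancel_right, fderiv_neg, inner_neg_left] at this
  simp only [neg_apply] at this
  linarith

/-- Moving the outer point of contact along the line through the inner one compares the second
derivative of `f` with that of `w`. -/
lemma iteratedFDeriv_le_secondD (h : IsContact f w F₀ ξ y e) (hf : ContDiff ℝ 2 f) (hw : IsMOC w) :
    iteratedFDeriv ℝ 2 f (y + ξ • e) ![e, e] ≤ secondD w ξ := by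
  have hξ := h.pos
  have hlr := hw.rightD_le_leftD hξ
  have hee : inner ℝ e e = (1 : ℝ) := by rw [real_inner_self_eq_norm_sq, h.norm_eq, one_pow]
  refine hw.le_secondD hξ (hasDerivAt_along hf (y + ξ • e) e)
    (hasDerivAt_fderiv_along hf (y + ξ • e) e) ?_ ?_ ?_
  · rw [zero_smul, add_zero, h.fderiv_eq hf hw le_rfl hlr, hee, mul_one]
  · rw [zero_smul, add_zero, h.fderiv_eq hf hw hlr le_rfl, hee, mul_one]
  · intro s hs
    have hn : ‖y + ξ • e + s • e - y‖ = ξ + s := by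
      rw [show y + ξ • e + s • e - y = (ξ + s) • e by module, norm_smul, h.norm_eq, mul_one,
        Real.norm_of_nonneg hs.le]
    have := h.le (y + ξ • e + s • e) y
      (fun h0 => by rw [h0, sub_self, norm_zero] at hn; linarith)
    rw [hn] at this
    rw [zero_smul, add_zero]
    linarith [h.eq]

/-- Moving both points of contact in parallel leaves their distance unchanged, so the second
derivatives of `f` in any direction are ordered. -/
lemma iteratedFDeriv_sub_nonpos (h : IsContact f w F₀ ξ y e) (hf : ContDiff ℝ 2 f) (hw : IsMOC w)
    (v : E n) :
    iteratedFDeriv ℝ 2 f (y + ξ • e) ![v, v] - iteratedFDeriv ℝ 2 f y ![v, v] ≤ 0 := by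
  have hlr := hw.rightD_le_leftD h.pos
  have := nonneg_of_isMin_of_hasDerivAt
    (g := fun s => f (y + s • v) - f (y + ξ • e + s • v))
    (fun s => (hasDerivAt_along hf y v s).sub (hasDerivAt_along hf (y + ξ • e) v s)) ?_
    ((hasDerivAt_fderiv_along hf y v).sub (hasDerivAt_fderiv_along hf (y + ξ • e) v)) ?_
  · linarith
  · simp only [zero_smul, add_zero]
    rw [h.fderiv_eq hf hw le_rfl hlr, h.fderiv_eq' hf hw le_rfl hlr, sub_self]
  · intro s
    have hn : ‖y + ξ • e + s • v - (y + s • v)‖ = ξ := by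
      rw [show y + ξ • e + s • v - (y + s • v) = ξ • e by module, norm_smul, h.norm_eq, mul_one,
        Real.norm_of_nonneg h.pos.le]
    have := h.le (y + ξ • e + s • v) (y + s • v)
      (fun h0 => by rw [h0, sub_self, norm_zero] at hn; linarith [h.pos])
    rw [hn] at this
    simp only [zero_smul, add_zero]
    linarith [h.eq]

/-- Each of the two points of contact contributes `w''` in the direction `e`; the other directions
contribute nothing positive. -/
lemma laplacian_sub_le {m : ℕ} {f : E (m + 1) → ℝ} {y e : E (m + 1)}
    (h : IsContact f w F₀ ξ y e) (hf : ContDiff ℝ 2 f) (hw : IsMOC w) :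
    Laplacian.laplacian f (y + ξ • e) - Laplacian.laplacian f y ≤ 2 * secondD w ξ := by
  obtain ⟨b, hb⟩ := Orthonormal.exists_orthonormalBasis_extension_of_card_eq (𝕜 := ℝ)
    (E := E (m + 1)) (ι := Fin (m + 1)) (by simp) (v := fun _ => e) (s := {0}) (by
      rw [orthonormal_subsingleton_iff]; intro; exact h.norm_eq)
  have hb0 : b 0 = e := hb 0 rfl
  rw [laplacian_eq_sum b, laplacian_eq_sum b, ← Finset.sum_sub_distrib, Fin.sum_univ_succ, hb0]
  have h1 := h.iteratedFDeriv_le_secondD hf hw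
  have h2 : -iteratedFDeriv ℝ 2 f y ![e, e] ≤ secondD w ξ := by
    have := h.neg.iteratedFDeriv_le_secondD hf.neg hw
    rw [smul_neg, add_neg_cancel_right] at this
    refine le_trans (le_of_eq ?_) this
    rw [iteratedFDeriv_neg]
    simp [iteratedFDeriv_two_apply]
  have h3 : ∑ i : Fin m, (iteratedFDeriv ℝ 2 f (y + ξ • e) ![b i.succ, b i.succ] -
      iteratedFDeriv ℝ 2 f y ![b i.succ, b i.succ]) ≤ 0 :=
    Finset.sum_nonpos fun i _ => h.iteratedFDeriv_sub_nonpos hf hw _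
  linarith

/-- The dissipation estimate at a contact, for all `0 < β ≤ 2`. -/
lemma fracLap_sub_le {m : ℕ} {f : E (m + 1) → ℝ} {y e : E (m + 1)}
    (h : IsContact f w F₀ ξ y e) (hf : ContDiff ℝ 2 f) {C : ℝ} (hC : ∀ x, |f x| ≤ C)
    (hw : IsMOC w) (hF : 0 ≤ F₀) {β : ℝ} (hβ : 0 < β) (hβ2 : β ≤ 2) :
    ((fracLap β f y - fracLap β f (y + ξ • e) : ℝ) : EReal) ≤
      Upsilon (dissipationConst m β) β w ξ := by
  rcases hβ2.eq_or_lt with rfl | hβ2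
  · rw [Upsilon, if_pos rfl, fracLap, if_pos rfl, fracLap, if_pos rfl, EReal.coe_le_coe_iff]
    linarith [h.laplacian_sub_le hf hw]
  · exact fracLap_sub_le_Upsilon hβ hβ2 hf hC hw hF h.norm_eq h.pos h.eq h.le

end IsContact

/-- The differential inequality excludes that the gap `θ(t,x) - θ(t,y) - ω(t,|x-y|)` has a
nonnegative maximum over the past at a positive time. -/
lemma not_isContact_of_lt {m : ℕ} {β ν ε T : ℝ} {u : ℝ → E (m + 1) → E (m + 1)}
    {θ : ℝ → E (m + 1) → ℝ} {ω : ℝ → ℝ → ℝ} {Ω₀ : ℝ} (hβ : 0 < β) (hβ2 : β ≤ 2) (hν : 0 < ν)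
    (hε : 0 ≤ ε) (hθ : IsSmoothSolution β ν ε T u θ) (hω : IsTimeMOC ω) {t : ℝ}
    (ht : t ∈ Ioc 0 T) {F₀ ξ : ℝ} (hF : 0 ≤ F₀) {y e : E (m + 1)}
    (hc : IsContact (θ t) (ω t) F₀ ξ y e)
    (hpast : ∀ s ∈ Ioo 0 t, θ s (y + ξ • e) - θ s y ≤ ω s ξ + F₀)
    (hu : |inner ℝ (u t (y + ξ • e) - u t y) e| ≤ Ω₀)
    (hlt : ((Ω₀ * upperD (ω t) ξ : ℝ) : EReal) +
        (ν : EReal) * Upsilon (dissipationConst m β) β (ω t) ξ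
          + ((2 * ε * secondD (ω t) ξ : ℝ) : EReal)
        < ((lowerD (fun s => ω s ξ) t : ℝ) : EReal)) : False := by
  obtain ⟨C, hC⟩ := hθ.bounded
  have hw := hω.isMOC t ht.1.le
  have hf := hθ.contDiff_space ht
  have hlr := hw.rightD_le_leftD hc.pos
  have hlap := hc.laplacian_sub_le hf hw
  have hfrac := hc.fracLap_sub_le hf (hC t ⟨ht.1.le, ht.2⟩) hw hF hβ hβ2
  set x := y + ξ • e with hx
  have htime : lowerD (fun s => ω s ξ) t ≤
      derivWithin (fun s => θ s x) (Icc 0 T) t - derivWithin (fun s => θ s y) (Icc 0 T) t := by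
    refine (min_le_left _ _).trans ?_
    have hω' : HasDerivWithinAt (fun s => ω s ξ) (leftD (fun s => ω s ξ) t) (Iio t) t := by
      obtain ⟨r, hr, h1, -⟩ := hω.piecewise_time ξ hc.pos t ht.1.le
      have h2 : DifferentiableWithinAt ℝ (fun s => ω s ξ) (Iio t) t := by
        refine ((h1.differentiableOn (by norm_num)) t
          ⟨ht.1.le, by linarith, le_rfl⟩).mono_of_mem_nhdsWithin ?_
        filter_upwards [Ioo_mem_nhdsLT ht.1, Ioo_mem_nhdsLT (by linarith : t - r < t)] with s h3 h4
        exact ⟨h3.1.le, h4.1.le, h4.2.le⟩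
      exact h2.hasDerivWithinAt
    have := nonneg_of_hasDerivWithinAt_Iio
      (((hθ.hasDerivWithinAt_time ht x).sub (hθ.hasDerivWithinAt_time ht y)).sub hω') (by
        filter_upwards [Ioo_mem_nhdsLT ht.1] with s hs
        simp only [Pi.sub_apply]
        linarith [hpast s hs, hc.eq])
    linarith
  have hgrad : inner ℝ (u t y) (gradient (θ t) y) - inner ℝ (u t x) (gradient (θ t) x) ≤
      Ω₀ * upperD (ω t) ξ := by
    rw [real_inner_comm, real_inner_comm (gradient (θ t) x), inner_gradient_left,
      inner_gradient_left, hc.fderiv_eq hf hw le_rfl hlr, hc.fderiv_eq' hf hw le_rfl hlr, ← mul_sub,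
      ← inner_sub_right, ← neg_sub (u t x), inner_neg_right, real_inner_comm]
    have h1 : -inner ℝ (u t x - u t y) e ≤ Ω₀ := (neg_le_abs _).trans hu
    have h2 : rightD (ω t) ξ ≤ upperD (ω t) ξ := le_max_right _ _
    have h3 : 0 ≤ Ω₀ := (abs_nonneg _).trans hu
    calc _ ≤ rightD (ω t) ξ * Ω₀ := mul_le_mul_of_nonneg_left h1 (hw.rightD_nonneg hc.pos)
      _ ≤ upperD (ω t) ξ * Ω₀ := mul_le_mul_of_nonneg_right h2 h3
      _ = _ := mul_comm _ _
  have heqx := hθ.equation t ht x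
  have heqy := hθ.equation t ht y
  have hreal : lowerD (fun s => ω s ξ) t ≤ Ω₀ * upperD (ω t) ξ +
      ν * (fracLap β (θ t) y - fracLap β (θ t) x) + 2 * ε * secondD (ω t) ξ := by
    have := mul_le_mul_of_nonneg_left hlap hε
    linarith
  refine absurd hlt (not_lt.2 ?_)
  refine (EReal.coe_le_coe_iff.2 hreal).trans ?_
  rw [EReal.coe_add, EReal.coe_add, EReal.coe_mul ν]
  gcongr

/-! ### Attainment of the largest gap -/

/-- A property of time and of a radius that holds for large radii, locally uniformly in time, does
so uniformly on compact time intervals. -/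
lemma exists_uniform_radius {T : ℝ} {P : ℝ → ℝ → Prop}
    (hmono : ∀ t R R', R ≤ R' → P R t → P R' t)
    (hloc : ∀ t ∈ Icc 0 T, ∃ R, ∃ h > 0, ∀ s ∈ Icc 0 T, |s - t| ≤ h → P R s) :
    ∃ R, ∀ t ∈ Icc 0 T, P R t := by
  refine isCompact_Icc.induction_on (p := fun S => ∃ R, ∀ t ∈ S, P R t) ⟨0, by simp⟩ ?_ ?_ ?_
  · rintro S S' hSS ⟨R, hR⟩
    exact ⟨R, fun t ht => hR t (hSS ht)⟩
  · rintro S S' ⟨R, hR⟩ ⟨R', hR'⟩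
    refine ⟨max R R', ?_⟩
    rintro t (ht | ht)
    · exact hmono t _ _ (le_max_left _ _) (hR t ht)
    · exact hmono t _ _ (le_max_right _ _) (hR' t ht)
  · intro t ht
    obtain ⟨R, h, hh, hR⟩ := hloc t ht
    refine ⟨Icc 0 T ∩ Metric.closedBall t h,
      inter_mem_nhdsWithin _ (Metric.closedBall_mem_nhds t hh), R, fun s hs => hR s hs.1 ?_⟩
    simpa [Real.dist_eq] using hs.2

namespace IsTimeMOC

variable {ω : ℝ → ℝ → ℝ}

lemma continuousOn_time (hω : IsTimeMOC ω) {ξ : ℝ} (hξ : 0 < ξ) :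
    ContinuousOn (fun t => ω t ξ) (Ici 0) := by
  intro t ht
  obtain ⟨r, hr, h1, h2⟩ := hω.piecewise_time ξ hξ t ht
  have h3 := (h1.continuousOn t ⟨ht, by linarith, le_rfl⟩).union
    (h2.continuousOn t ⟨ht, le_rfl, by linarith⟩)
  refine h3.mono_of_mem_nhdsWithin ?_
  filter_upwards [self_mem_nhdsWithin,
    mem_nhdsWithin_of_mem_nhds (Icc_mem_nhds (by linarith : t - r < t) (by linarith : t < t + r))]
    with s hs hsr
  rcases le_total s t with hst | hst
  · exact Or.inl ⟨hs, hsr.1, hst⟩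
  · exact Or.inr ⟨hs, hst, hsr.2⟩

/-- Separate continuity together with monotonicity in `ξ` gives joint continuity. -/
lemma continuousOn_uncurry (hω : IsTimeMOC ω) :
    ContinuousOn (Function.uncurry ω) (Ici 0 ×ˢ Ioi 0) := by
  rintro ⟨t, ξ⟩ ⟨ht, hξ⟩
  have ht : 0 ≤ t := ht
  have hξ : 0 < ξ := hξ
  have hcξ : ContinuousAt (ω t) ξ := (hω.isMOC t ht).continuousOn.continuousAt (Ioi_mem_nhds hξ)
  have hmem : ∀ U ∈ 𝓝[Ici 0] t, ∀ V ∈ 𝓝 ξ, U ×ˢ V ∈ 𝓝[Ici 0 ×ˢ Ioi 0] ((t, ξ) : ℝ × ℝ) := by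
    intro U hU V hV
    rw [nhdsWithin_prod_eq]
    exact prod_mem_prod hU (mem_nhdsWithin_of_mem_nhds hV)
  refine tendsto_order.2 ⟨fun a ha => ?_, fun a ha => ?_⟩
  · obtain ⟨ξ₁, h1, h2⟩ := (((hcξ.eventually (lt_mem_nhds ha)).filter_mono
      (nhdsWithin_le_nhds (s := Iio ξ))).and (Ioo_mem_nhdsLT hξ)).exists
    filter_upwards [hmem _ ((hω.continuousOn_time h2.1 t ht).eventually (lt_mem_nhds h1)) _
      (Ioi_mem_nhds h2.2), self_mem_nhdsWithin] with p hp hp'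
    exact lt_of_lt_of_le hp.1 ((hω.isMOC p.1 hp'.1).monotoneOn h2.1 hp'.2 (le_of_lt hp.2))
  · obtain ⟨ξ₁, h1, h2⟩ := (((hcξ.eventually (gt_mem_nhds ha)).filter_mono
      (nhdsWithin_le_nhds (s := Ioi ξ))).and self_mem_nhdsWithin).exists
    have h2 : ξ < ξ₁ := h2
    have h3 : 0 < ξ₁ := hξ.trans h2
    filter_upwards [hmem _ ((hω.continuousOn_time h3 t ht).eventually (gt_mem_nhds h1)) _
      (Iio_mem_nhds h2), self_mem_nhdsWithin] with p hp hp'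
    exact lt_of_le_of_lt ((hω.isMOC p.1 hp'.1).monotoneOn hp'.2 h3 (le_of_lt hp.2)) hp.1

/-- Beyond a radius that is uniform in time the modulus is at least `2N`. -/
lemma exists_radius (hω : IsTimeMOC ω) {T δ₁ N : ℝ} (hδ0 : 2 / 3 ≤ δ₁) (hδ1 : δ₁ < 1) (hN : 0 < N)
    (hinv : ∀ t ≥ 0, mocInv (ω t) (2 / δ₁ * N) < ⊤) :
    ∃ M, ∀ t ∈ Icc 0 T, ∀ ξ > M, 0 < ξ → 2 * N ≤ ω t ξ := by
  refine exists_uniform_radius (P := fun M t => ∀ ξ > M, 0 < ξ → 2 * N ≤ ω t ξ)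
    (fun t R R' hRR h ξ hξ => h ξ (lt_of_le_of_lt hRR hξ)) fun t ht => ?_
  obtain ⟨ξ₀, h0, hle⟩ : ∃ ξ₀ > 0, 2 / δ₁ * N ≤ ω t ξ₀ := by
    by_contra! hcon
    refine (hinv t ht.1).ne ?_
    simp only [mocInv, iInf_eq_top]
    intro ξ hξ hle
    exact absurd hle (not_le.2 (hcon ξ hξ))
  obtain ⟨M, hM, hunif⟩ := hω.uniform_at_infinity t ht.1
  have hgap : 0 < 2 / δ₁ * N - 2 * N := by
    have : 2 < 2 / δ₁ := by rw [lt_div_iff₀ (by linarith)]; linarith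
    nlinarith
  obtain ⟨h, hh, hclose⟩ := hunif _ hgap
  refine ⟨max M ξ₀, h, hh, fun s hs hst ξ hξ hξ0 => ?_⟩
  have h1 := (abs_le.1 (hclose s hs.1 hst ξ ((le_max_left _ _).trans hξ.le))).1
  have h2 := (hω.isMOC t ht.1).monotoneOn h0 hξ0 ((le_max_right _ _).trans hξ.le)
  linarith

end IsTimeMOC

namespace IsSmoothSolution

variable {n : ℕ} {β ν ε T : ℝ} {u : ℝ → E n → E n} {θ : ℝ → E n → ℝ}

lemma contDiff_one (h : IsSmoothSolution β ν ε T u θ) {t : ℝ} (ht : t ∈ Icc 0 T) :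
    ContDiff ℝ 1 (θ t) := by
  rcases ht.1.eq_or_lt with h0 | h0
  · rw [← h0]; exact h.initial_C1
  · exact (h.contDiff_space ⟨h0, ht.2⟩).of_le (by norm_num)

lemma norm_fderiv_eq (f : E n → ℝ) (x : E n) : ‖fderiv ℝ f x‖ = ‖gradient f x‖ := by
  rw [gradient, LinearIsometryEquiv.norm_map]

/-- The gradient vanishes at infinity uniformly in time, the initial time included. -/
lemma exists_radius_gradient_le (h : IsSmoothSolution β ν ε T u θ) (hT : 0 < T)
    (hdecay : ∀ t ∈ Ioc 0 T, Tendsto (fun x => ‖gradient (θ t) x‖) (cocompact (E n)) (𝓝 0))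
    {e : ℝ} (he : 0 < e) :
    ∃ R, ∀ t ∈ Icc 0 T, ∀ x, R < ‖x‖ → ‖gradient (θ t) x‖ ≤ e := by
  refine exists_uniform_radius (P := fun R t => ∀ x : E n, R < ‖x‖ → ‖gradient (θ t) x‖ ≤ e)
    (fun t R R' hRR hP x hx => hP x (hRR.trans_lt hx)) fun t ht => ?_
  obtain ⟨r, hr, hclose⟩ := h.gradient_continuous t ht (e / 4) (by linarith)
  obtain ⟨s₀, hs₀, hst₀⟩ : ∃ s₀ ∈ Ioc 0 T, |s₀ - t| ≤ r := by
    rcases ht.1.eq_or_lt with h0 | h0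
    · refine ⟨min r T, ⟨lt_min hr hT, min_le_right _ _⟩, ?_⟩
      rw [← h0, sub_zero, abs_of_pos (lt_min hr hT)]
      exact min_le_left _ _
    · exact ⟨t, ⟨h0, ht.2⟩, by simpa using hr.le⟩
  have hev := (hdecay s₀ hs₀).eventually (gt_mem_nhds (by linarith : 0 < e / 4))
  rw [← Metric.cobounded_eq_cocompact, ← comap_norm_atTop] at hev
  obtain ⟨R, hR⟩ := eventually_atTop.1 (eventually_comap.1 hev)
  refine ⟨R, r, hr, fun s hs hst x hx => ?_⟩
  have h1 := hclose s hs hst x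
  have h2 := hclose s₀ ⟨hs₀.1.le, hs₀.2⟩ hst₀ x
  have h3 := hR ‖x‖ hx.le x rfl
  rw [norm_sub_rev] at h2
  calc ‖gradient (θ s) x‖ = ‖(gradient (θ s) x - gradient (θ t) x) +
        (gradient (θ t) x - gradient (θ s₀) x) + gradient (θ s₀) x‖ := by congr 1; module
    _ ≤ ‖gradient (θ s) x - gradient (θ t) x‖ + ‖gradient (θ t) x - gradient (θ s₀) x‖ +
        ‖gradient (θ s₀) x‖ := norm_add₃_le
    _ ≤ e := by linarith

lemma exists_gradient_bound (h : IsSmoothSolution β ν ε T u θ) (hT : 0 < T)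
    (hdecay : ∀ t ∈ Ioc 0 T, Tendsto (fun x => ‖gradient (θ t) x‖) (cocompact (E n)) (𝓝 0)) :
    ∃ G, ∀ t ∈ Icc 0 T, ∀ x, ‖gradient (θ t) x‖ ≤ G := by
  obtain ⟨R, hR⟩ := h.exists_radius_gradient_le hT hdecay one_pos
  refine exists_uniform_radius (P := fun G t => ∀ x : E n, ‖gradient (θ t) x‖ ≤ G)
    (fun t G G' hGG hP x => (hP x).trans hGG) fun t ht => ?_
  obtain ⟨r, hr, hclose⟩ := h.gradient_continuous t ht 1 one_pos
  have hcont : Continuous fun x => ‖gradient (θ t) x‖ := by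
    simp only [← norm_fderiv_eq]
    exact ((h.contDiff_one ht).continuous_fderiv (by norm_num)).norm
  obtain ⟨B, hB⟩ := (isCompact_closedBall (0 : E n) R).exists_bound_of_continuousOn
    hcont.continuousOn
  refine ⟨max B 1 + 1, r, hr, fun s hs hst x => ?_⟩
  have h1 := hclose s hs hst x
  have h2 : ‖gradient (θ t) x‖ ≤ max B 1 := by
    rcases le_or_gt ‖x‖ R with hx | hx
    · have := hB x (by simpa using hx)
      rw [norm_norm] at this
      exact this.trans (le_max_left _ _)
    · exact (hR t ht x hx).trans (le_max_right _ _)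
  have h3 := norm_sub_norm_le (gradient (θ s) x) (gradient (θ t) x)
  linarith

lemma abs_sub_le (h : IsSmoothSolution β ν ε T u θ) {t : ℝ} (ht : t ∈ Icc 0 T) {x y : E n} {G : ℝ}
    (hG : ∀ z ∈ Metric.closedBall x ‖y - x‖, ‖gradient (θ t) z‖ ≤ G) :
    |θ t y - θ t x| ≤ G * ‖y - x‖ := by
  refine (convex_closedBall x ‖y - x‖).norm_image_sub_le_of_norm_fderiv_le (𝕜 := ℝ)
    (fun z _ => (h.contDiff_one ht).differentiable (by norm_num) z)
    (fun z hz => ?_) (by simp) (by simp [dist_eq_norm])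
  rw [norm_fderiv_eq]
  exact hG z hz

/-- A positive gap somewhere implies that the largest gap is attained: gaps above a positive level
confine the two points to a compact set and keep them apart. -/
lemma exists_isMax_gap (h : IsSmoothSolution β ν ε T u θ) (hT : 0 < T)
    (hdecay : ∀ t ∈ Ioc 0 T, Tendsto (fun x => ‖gradient (θ t) x‖) (cocompact (E n)) (𝓝 0))
    {ω : ℝ → ℝ → ℝ} (hω : IsTimeMOC ω) {M N : ℝ} (hN : ∀ t ∈ Icc 0 T, ∀ x, |θ t x| ≤ N)
    (hM : ∀ t ∈ Icc 0 T, ∀ ξ > M, 0 < ξ → 2 * N ≤ ω t ξ)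
    {t₀ : ℝ} (ht₀ : t₀ ∈ Icc 0 T) {x₀ y₀ : E n} (hne₀ : x₀ ≠ y₀)
    (hpos : 0 < θ t₀ x₀ - θ t₀ y₀ - ω t₀ ‖x₀ - y₀‖) :
    ∃ t ∈ Icc 0 T, ∃ x y, x ≠ y ∧ 0 < θ t x - θ t y - ω t ‖x - y‖ ∧
      ∀ s ∈ Icc 0 T, ∀ x' y', x' ≠ y' →
        θ s x' - θ s y' - ω s ‖x' - y'‖ ≤ θ t x - θ t y - ω t ‖x - y‖ := by
  set F : ℝ × E n × E n → ℝ := fun p => θ p.1 p.2.1 - θ p.1 p.2.2 - ω p.1 ‖p.2.1 - p.2.2‖ with hF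
  set c := F (t₀, x₀, y₀) with hc
  have hc0 : 0 < c := hpos
  obtain ⟨G, hG⟩ := h.exists_gradient_bound hT hdecay
  set G' := max G 1 with hG'
  have hG'0 : 0 < G' := lt_of_lt_of_le one_pos (le_max_right _ _)
  set M' := max M 1 with hM'
  have hM'0 : 0 < M' := lt_of_lt_of_le one_pos (le_max_right _ _)
  obtain ⟨R, hR⟩ := h.exists_radius_gradient_le hT hdecay (by positivity : 0 < c / (2 * M'))
  have hwpos : ∀ t ∈ Icc 0 T, ∀ x y : E n, x ≠ y → 0 < ω t ‖x - y‖ := fun t ht x y hne =>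
    (hω.isMOC t ht.1).pos _ (norm_pos_iff.2 (sub_ne_zero.2 hne))
  have hfar : ∀ t ∈ Icc 0 T, ∀ x y : E n, x ≠ y → c ≤ F (t, x, y) → ‖x - y‖ ≤ M' := by
    intro t ht x y hne hle
    by_contra! hlt
    have h1 := hM t ht ‖x - y‖ ((le_max_left _ _).trans_lt hlt) (hM'0.trans hlt)
    have h2 := (abs_le.1 (hN t ht x)).2
    have h3 := (abs_le.1 (hN t ht y)).1
    simp only [hF] at hle
    linarith
  have hnear : ∀ t ∈ Icc 0 T, ∀ x y : E n, x ≠ y → c ≤ F (t, x, y) → c / G' ≤ ‖x - y‖ := by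
    intro t ht x y hne hle
    have h1 := (le_abs_self _).trans (h.abs_sub_le ht (x := y) (y := x) (G := G')
      fun z _ => (hG t ht z).trans (le_max_left _ _))
    rw [div_le_iff₀ hG'0]
    have h2 := hwpos t ht x y hne
    simp only [hF] at hle
    linarith
  have hbdd : ∀ t ∈ Icc 0 T, ∀ x y : E n, x ≠ y → c ≤ F (t, x, y) → ‖x‖ ≤ R + M' := by
    intro t ht x y hne hle
    by_contra! hlt
    have h0 := hfar t ht x y hne hle
    have h1 := (neg_le_abs _).trans (h.abs_sub_le ht (x := x) (y := y) (G := c / (2 * M'))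
      fun z hz => hR t ht z ?_)
    · have h2 := hwpos t ht x y hne
      have h3 : c / (2 * M') * ‖y - x‖ ≤ c / (2 * M') * M' := by
        rw [norm_sub_rev]; gcongr
      have h4 : c / (2 * M') * M' = c / 2 := by field_simp
      simp only [hF] at hle
      linarith
    · rw [mem_closedBall_iff_norm', norm_sub_rev y x] at hz
      have := norm_sub_norm_le x z
      linarith
  set K : Set (ℝ × E n × E n) := (Icc 0 T ×ˢ (Metric.closedBall (0 : E n) (R + M') ×ˢ
    Metric.closedBall (0 : E n) (R + M' + M'))) ∩ {p | c / G' ≤ ‖p.2.1 - p.2.2‖} with hK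
  have hKc : IsCompact K := (isCompact_Icc.prod ((isCompact_closedBall _ _).prod
    (isCompact_closedBall _ _))).inter_right (isClosed_le continuous_const (by fun_prop))
  have hKmem : ∀ t ∈ Icc 0 T, ∀ x y : E n, x ≠ y → c ≤ F (t, x, y) → (t, x, y) ∈ K := by
    intro t ht x y hne hle
    have h1 := hbdd t ht x y hne hle
    have h2 := hfar t ht x y hne hle
    refine ⟨⟨ht, by simpa using h1, ?_⟩, hnear t ht x y hne hle⟩
    have := norm_sub_norm_le y x
    rw [norm_sub_rev] at this
    simp only [Metric.mem_closedBall, dist_zero_right]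
    linarith
  have hFc : ContinuousOn F K := by
    refine ContinuousOn.sub (ContinuousOn.sub ?_ ?_) ?_
    · exact h.continuousOn.comp (f := fun p : ℝ × E n × E n => (p.1, p.2.1)) (by fun_prop)
        fun p hp => ⟨hp.1.1, mem_univ _⟩
    · exact h.continuousOn.comp (f := fun p : ℝ × E n × E n => (p.1, p.2.2)) (by fun_prop)
        fun p hp => ⟨hp.1.1, mem_univ _⟩
    · exact hω.continuousOn_uncurry.comp (f := fun p : ℝ × E n × E n => (p.1, ‖p.2.1 - p.2.2‖))
        (by fun_prop) fun p hp => ⟨hp.1.1.1, (div_pos hc0 hG'0).trans_le hp.2⟩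
  have h0K := hKmem t₀ ht₀ x₀ y₀ hne₀ le_rfl
  obtain ⟨⟨t, x, y⟩, hp, hmax⟩ := hKc.exists_isMaxOn ⟨_, h0K⟩ hFc
  have hcF : c ≤ F (t, x, y) := hmax h0K
  refine ⟨t, hp.1.1, x, y, ?_, hc0.trans_le hcF, fun s hs x' y' hne => ?_⟩
  · rintro rfl
    have : c / G' ≤ ‖x - x‖ := hp.2
    rw [sub_self, norm_zero] at this
    exact absurd this (not_le.2 (by positivity))
  · rcases le_or_gt c (F (s, x', y')) with hle | hlt
    · exact hmax (hKmem s hs x' y' hne hle)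
    · exact hlt.le.trans hcF

end IsSmoothSolution

end ActiveScalar

/-! ### Persistence of the modulus of continuity -/

open ActiveScalar

theorem proposition3p1 (n : ℕ) (hn : 1 ≤ n) (β : ℝ) (hβ : 0 < β) (hβ2 : β ≤ 2) :
    ∃ c > 0, ∀ (ν ε T δ₁ : ℝ) (u : ℝ → E n → E n) (θ : ℝ → E n → ℝ) (ω Ω : ℝ → ℝ → ℝ),
      0 < ν → 0 ≤ ε → 0 < T → 2 / 3 ≤ δ₁ → δ₁ < 1 →
      -- the solution and the spatial decay of its gradient
      IsSmoothSolution β ν ε T u θ →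
      (∀ t ∈ Ioc 0 T, Tendsto (fun x => ‖gradient (θ t) x‖) (cocompact (E n)) (𝓝 0)) →
      -- the time-dependent modulus of continuity
      IsTimeMOC ω →
      (∀ t ≥ 0, mocInv (ω t) (2 / δ₁ * supNorm (θ 0)) < ⊤) →
      GoodAtZero ω →
      Obeys (θ 0) (ω 0) →
      -- the bound of the velocity increments
      (∀ t ∈ Ioc 0 T, ∀ ξ > 0, ω t ξ ≤ 2 * supNorm (θ t) →
        ∀ x e : E n, ‖e‖ = 1 → |inner ℝ (u t (x + ξ • e) - u t x) e| ≤ Ω t ξ) →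
      -- the differential inequality
      (∀ t ∈ Ioc 0 T, ∀ ξ > 0, ω t ξ ≤ 2 * supNorm (θ t) →
        ((Ω t ξ * upperD (ω t) ξ : ℝ) : EReal) + (ν : EReal) * Upsilon c β (ω t) ξ
            + ((2 * ε * secondD (ω t) ξ : ℝ) : EReal)
          < ((lowerD (fun s => ω s ξ) t : ℝ) : EReal)) →
      Obeys (θ T) (ω T) := by
  obtain ⟨m, rfl⟩ : ∃ m, n = m + 1 := ⟨n - 1, by omega⟩
  refine ⟨dissipationConst m β, dissipationConst_pos m hβ hβ2, ?_⟩
  intro ν ε T δ₁ u θ ω Ω hν hε hT hδ0 hδ1 hθ hdecay hω hinv _ hinit hu hineq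
  obtain ⟨C, hC⟩ := hθ.bounded
  have hTT : T ∈ Icc 0 T := ⟨hT.le, le_rfl⟩
  have hN : ∀ t ∈ Icc 0 T, ∀ x, |θ t x| ≤ supNorm (θ 0) := fun t ht x =>
    hθ.abs_le_supNorm_initial hn hβ hβ2 hν hε ht x
  -- A nonnegative largest gap is excluded at time zero by the strict inequality for the initial datum,
  -- and at positive times by the differential inequality.
  have key : ∀ t ∈ Icc 0 T, ∀ x y, x ≠ y → 0 ≤ θ t x - θ t y - ω t ‖x - y‖ →
      (∀ s ∈ Icc 0 T, ∀ x' y', x' ≠ y' →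
        θ s x' - θ s y' - ω s ‖x' - y'‖ ≤ θ t x - θ t y - ω t ‖x - y‖) → False := by
    intro t ht x y hne hF hmax
    have hξ : 0 < ‖x - y‖ := norm_pos_iff.2 (sub_ne_zero.2 hne)
    rcases ht.1.eq_or_lt with h0 | h0
    · have := (le_abs_self _).trans_lt (hinit x y hne)
      rw [← h0] at hF
      linarith
    · have ht' : t ∈ Ioc 0 T := ⟨h0, ht.2⟩
      set ξ := ‖x - y‖ with hξdef
      set e := ξ⁻¹ • (x - y) with he
      have he1 : ‖e‖ = 1 := by
        rw [he, norm_smul, norm_inv, norm_norm, ← hξdef, inv_mul_cancel₀ hξ.ne']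
      have hx : y + ξ • e = x := by
        rw [he, smul_smul, mul_inv_cancel₀ hξ.ne', one_smul, add_sub_cancel]
      have hsup : ω t ξ ≤ 2 * supNorm (θ t) := by
        have h1 := (abs_le.1 (abs_le_supNorm (hC t ht) x)).2
        have h2 := (abs_le.1 (abs_le_supNorm (hC t ht) y)).1
        linarith
      refine not_isContact_of_lt hβ hβ2 hν hε hθ hω ht' (F₀ := θ t x - θ t y - ω t ξ) hF
        (y := y) (e := e) (ξ := ξ) ⟨he1, hξ, by rw [hx]; ring, fun x' y' hne' => ?_⟩ ?_
        (hu t ht' ξ hξ hsup y e he1) (hineq t ht' ξ hξ hsup)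
      · linarith [hmax t ht x' y' hne']
      · intro s hs
        rw [hx]
        have := hmax s ⟨hs.1.le, hs.2.le.trans ht.2⟩ x y hne
        linarith
  have hle : ∀ t ∈ Icc 0 T, ∀ x y, x ≠ y → θ t x - θ t y - ω t ‖x - y‖ ≤ 0 := by
    intro t₀ ht₀ x₀ y₀ hne₀
    by_contra! hpos
    have hw : 0 < ω t₀ ‖x₀ - y₀‖ :=
      (hω.isMOC t₀ ht₀.1).pos _ (norm_pos_iff.2 (sub_ne_zero.2 hne₀))
    have hN0 : 0 < supNorm (θ 0) := by
      have h1 := (abs_le.1 (hN t₀ ht₀ x₀)).2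
      have h2 := (abs_le.1 (hN t₀ ht₀ y₀)).1
      linarith
    obtain ⟨M, hM⟩ := hω.exists_radius (T := T) hδ0 hδ1 hN0 hinv
    obtain ⟨t, ht, x, y, hne, hF, hmax⟩ :=
      hθ.exists_isMax_gap hT hdecay hω hN hM ht₀ hne₀ hpos
    exact key t ht x y hne hF.le hmax
  -- All gaps being nonpositive, a vanishing gap at time `T` would again be a largest one.
  have hlt : ∀ x y, x ≠ y → θ T x - θ T y < ω T ‖x - y‖ := by
    intro x y hne
    by_contra! hge
    exact key T hTT x y hne (by linarith) fun s hs x' y' hne' =>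
      (hle s hs x' y' hne').trans (by linarith)
  intro x y hne
  refine abs_lt.2 ⟨?_, hlt x y hne⟩
  have := hlt y x hne.symm
  rw [norm_sub_rev] at this
  linarith
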